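/- **Proposition 2.6 (liaison addition for products).** Let $k$ be a field of characteristic zero and $R=k[x_0,x_1,x_2,x_3]$. For a product $F$ of pairwise linearly independent linear forms in $R$ with at least two factors, let $J_F=\langle F_{x_0},\dots,F_{x_3}\rangle$ be its Jacobian ideal and let $\overline J_F$ be the intersection of the height two components in a minimal primary decomposition of $J_F$. Let $\overline C_F$ and $C_F^{red}$ be the curves in $\mathbb P^3$ defined by $\overline J_F$ and $\sqrt{J_F}$, respectively. For a curve $C\subset\mathbb P^3$ with ideal sheaf $\mathcal I_C$, let $M(C)=\bigoplus_{t\in\mathbb Z}H^1(\mathbb P^3,\mathcal I_C(t))$ be its Hartshorne–Rao module, a graded $R$-module. For a graded module $M$, the twist $M(a)$ is given by $M(a)_t=M_{a+t}$. Let $m,p\ge 2$, and let $F=L_1\cdots L_m$ and $G=M_1\cdots M_p$, where $L_1,\dots,L_m\in R$ are pairwise linearly independent linear forms and $M_1,\dots,M_p\in R$ are pairwise linearly independent linear forms. Assume that $G$ does not vanish on any component of $C_F^{red}$ and that $F$ does not vanish on any component of $C_G^{red}$. Then there are isomorphisms of graded $R$-modules $$M(\overline C_{FG})\cong M(\overline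 C_F)(-p)\oplus M(\overline C_G)(-m)$$ and $$M(C_{FG}^{red})\cong M(C_F^{red})(-p)\oplus M(C_G^{red})(-m).$$ -/

import Mathlib

noncomputable section

namespace ProductArrangement

open MvPolynomial

/-- The homogeneous coordinate ring `k[x₀, x₁, x₂, x₃]` of projective three-space over `k`. -/
abbrev Coord (k : Type*) [Field k] : Type _ := MvPolynomial (Fin 4) k

/-- The field of fractions of the homogeneous coordinate ring. All localizations of `Coord k` and of
its ideals are regarded as subsets of this field. -/
abbrev Frac (k : Type*) [Field k] : Type _ := FractionRing (Coord k)

/-! ### Jacobian ideals and their top-dimensional part -/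

/-- The Jacobian ideal of `F`, generated by the four first partial derivatives of `F`. -/
def jacobianIdeal {k : Type*} [Field k] (F : Coord k) : Ideal (Coord k) :=
  Ideal.span (Set.range fun i : Fin 4 => pderiv i F)

/-- `Q` is the top-dimensional part of the codimension two ideal `J`: the intersection of the
components of height two in a (minimal) primary decomposition of `J`. -/
def IsTopDimensionalPart {k : Type*} [Field k] (J Q : Ideal (Coord k)) : Prop :=
  ∃ t : Finset (Ideal (Coord k)), Submodule.IsMinimalPrimaryDecomposition J t ∧
    Q = ⨅ q ∈ {q : Ideal (Coord k) | q ∈ t ∧ q.height = 2}, q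

theorem exists_isTopDimensionalPart {k : Type*} [Field k] (J : Ideal (Coord k)) :
    ∃ Q : Ideal (Coord k), IsTopDimensionalPart J Q := by
  obtain ⟨t, ht⟩ := Submodule.IsLasker.exists_isMinimalPrimaryDecomposition (Submodule.isLasker _ _) J
  exact ⟨_, t, ht, rfl⟩

/-! ### The Hartshorne-Rao module

Let `C` be the closed subscheme of `ℙ³` defined by a homogeneous ideal `I`, so that its ideal sheaf
is the sheaf associated with `I`. The graded module `⨁ₜ H¹(ℙ³, 𝓘_C(t))` is computed by the Čech
complex of the sheaves `𝓘_C(t)` for the standard affine cover `D₊(x₀), …, D₊(x₃)`. On the open set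
`D₊(h)` the sections of `𝓘_C(t)` are the elements of degree `t` in the localization `I_h`, and the
sum of these over all integers `t` is `I_h`. -/

/-- The localization `I_h = {f / hⁿ | f ∈ I, n ≥ 0}`, inside the field of fractions. -/
def sectionsOn {k : Type*} [Field k] (I : Ideal (Coord k)) (h : Coord k) :
    Submodule (Coord k) (Frac k) where
  carrier := {g | ∃ n : ℕ, ∃ f ∈ I, algebraMap (Coord k) (Frac k) (h ^ n) * g
    = algebraMap (Coord k) (Frac k) f}
  zero_mem' := ⟨0, 0, I.zero_mem, by simp⟩
  add_mem' := by
    rintro a b ⟨n, f, hf, hn⟩ ⟨n', f', hf', hn'⟩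
    refine ⟨n + n', h ^ n' * f + h ^ n * f',
      I.add_mem (I.mul_mem_left _ hf) (I.mul_mem_left _ hf'), ?_⟩
    rw [map_add, map_mul, map_mul, ← hn, ← hn', pow_add, map_mul]
    ring
  smul_mem' := by
    rintro c a ⟨n, f, hf, hn⟩
    refine ⟨n, c * f, I.mul_mem_left _ hf, ?_⟩
    rw [map_mul, ← hn, Algebra.smul_def]
    ring

/-- The fractions that are homogeneous of degree `t`: quotients of a form of degree `d` by a nonzero
form of degree `e`, where `d - e = t`. -/
def fractionsOfDegree (k : Type*) [Field k] (t : ℤ) : Submodule k (Frac k) where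
  carrier := {g | ∃ (d e : ℕ) (a b : Coord k), a.IsHomogeneous d ∧ b.IsHomogeneous e ∧ b ≠ 0 ∧
    (d : ℤ) - e = t ∧
    algebraMap (Coord k) (Frac k) b * g = algebraMap (Coord k) (Frac k) a}
  zero_mem' := by
    refine ⟨t.toNat, (-t).toNat, 0, X 0 ^ (-t).toNat, isHomogeneous_zero _ _ _, ?_,
      pow_ne_zero _ (X_ne_zero 0), by omega, by simp⟩
    simpa using (isHomogeneous_X k (0 : Fin 4)).pow (-t).toNat
  add_mem' := by
    rintro g g' ⟨d, e, a, b, ha, hb, hb0, ht, h⟩ ⟨d', e', a', b', ha', hb', hb0', ht', h'⟩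
    refine ⟨d + e', e + e', a * b' + b * a', b * b', (ha.mul hb').add ?_, hb.mul hb',
      mul_ne_zero hb0 hb0', by push_cast; omega, ?_⟩
    · have hd : d + e' = e + d' := by omega
      rw [hd]
      exact hb.mul ha'
    · rw [map_add, map_mul, map_mul, map_mul, ← h, ← h']
      ring
  smul_mem' := by
    rintro c g ⟨d, e, a, b, ha, hb, hb0, ht, h⟩
    refine ⟨d, e, C c * a, b, ?_, hb, hb0, ht, ?_⟩
    · simpa using (isHomogeneous_C (Fin 4) c).mul ha
    · rw [map_mul, ← h, Algebra.smul_def, IsScalarTower.algebraMap_apply k (Coord k) (Frac k),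
        MvPolynomial.algebraMap_eq]
      ring

/-- Čech `0`-cochains: families `(b i)` with `b i` a section over `D₊(xᵢ)`. -/
def cochain₀ {k : Type*} [Field k] (I : Ideal (Coord k)) :
    Submodule (Coord k) (Fin 4 → Frac k) where
  carrier := {b | ∀ i, b i ∈ sectionsOn I (X i)}
  zero_mem' := fun _ => Submodule.zero_mem _
  add_mem' := fun ha hb i => Submodule.add_mem _ (ha i) (hb i)
  smul_mem' := fun c _ hb i => Submodule.smul_mem _ c (hb i)

/-- Čech `1`-cochains: families `(c i j)` with `c i j` a section over `D₊(xᵢxⱼ)`. -/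
def cochain₁ {k : Type*} [Field k] (I : Ideal (Coord k)) :
    Submodule (Coord k) (Fin 4 → Fin 4 → Frac k) where
  carrier := {c | ∀ i j, c i j ∈ sectionsOn I (X i * X j)}
  zero_mem' := fun _ _ => Submodule.zero_mem _
  add_mem' := fun ha hb i j => Submodule.add_mem _ (ha i j) (hb i j)
  smul_mem' := fun a _ hb i j => Submodule.smul_mem _ a (hb i j)

/-- The Čech differential `(δb) i j = b j - b i` on `0`-cochains. -/
def delta₀ (k : Type*) [Field k] :
    (Fin 4 → Frac k) →ₗ[Coord k] (Fin 4 → Fin 4 → Frac k) where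
  toFun b := fun i j => b j - b i
  map_add' a b := by funext i j; simp only [Pi.add_apply]; ring
  map_smul' r b := by funext i j; simp only [Pi.smul_apply, RingHom.id_apply, smul_sub]

/-- The Čech differential `(δc) i j l = c j l - c i l + c i j` on `1`-cochains. -/
def delta₁ (k : Type*) [Field k] :
    (Fin 4 → Fin 4 → Frac k) →ₗ[Coord k] (Fin 4 → Fin 4 → Fin 4 → Frac k) where
  toFun c := fun i j l => c j l - c i l + c i j
  map_add' a b := by funext i j l; simp only [Pi.add_apply]; ring
  map_smul' r b := by
    funext i j l; simp only [Pi.smul_apply, RingHom.id_apply, smul_sub, smul_add]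

/-- Čech `1`-cocycles. -/
def cocycle₁ {k : Type*} [Field k] (I : Ideal (Coord k)) :
    Submodule (Coord k) (Fin 4 → Fin 4 → Frac k) :=
  cochain₁ I ⊓ LinearMap.ker (delta₁ k)

/-- Čech `1`-coboundaries. -/
def coboundary₁ {k : Type*} [Field k] (I : Ideal (Coord k)) :
    Submodule (Coord k) (Fin 4 → Fin 4 → Frac k) :=
  (cochain₀ I).map (delta₀ k)

theorem coboundary₁_le_cocycle₁ {k : Type*} [Field k] (I : Ideal (Coord k)) :
    coboundary₁ I ≤ cocycle₁ I := by
  rintro _ ⟨b, hb, rfl⟩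
  refine ⟨fun i j => ?_, ?_⟩
  · obtain ⟨n, f, hf, hn⟩ := hb i
    obtain ⟨n', f', hf', hn'⟩ := hb j
    refine Submodule.sub_mem _ ⟨n', X i ^ n' * f', I.mul_mem_left _ hf', ?_⟩
      ⟨n, X j ^ n * f, I.mul_mem_left _ hf, ?_⟩
    · rw [map_mul, ← hn', mul_pow, map_mul]
      ring
    · rw [map_mul, ← hn, mul_pow, map_mul]
      ring
  · change delta₁ k (delta₀ k b) = 0
    funext i j l
    simp only [delta₁, delta₀, LinearMap.coe_mk, AddHom.coe_mk, Pi.zero_apply]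
    ring

/-- The Hartshorne-Rao module `M(C) = ⨁ₜ H¹(ℙ³, 𝓘_C(t))` of the closed subscheme `C` of `ℙ³` defined
by the ideal `I`: Čech `1`-cocycles modulo `1`-coboundaries. -/
abbrev HartshorneRao {k : Type*} [Field k] (I : Ideal (Coord k)) : Type _ :=
  cocycle₁ I ⧸ (coboundary₁ I).submoduleOf (cocycle₁ I)

/-- The graded piece `M(C)ₜ = H¹(ℙ³, 𝓘_C(t))`: the classes of the cocycles whose entries are all
homogeneous of degree `t`. -/
def hartshorneRaoDegree {k : Type*} [Field k] (I : Ideal (Coord k)) (t : ℤ) :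
    Submodule k (HartshorneRao I) where
  carrier := {z | ∃ c : cocycle₁ I, (∀ i j, c.1 i j ∈ fractionsOfDegree k t) ∧
    Submodule.Quotient.mk c = z}
  zero_mem' := ⟨0, fun _ _ => Submodule.zero_mem _, rfl⟩
  add_mem' := by
    rintro _ _ ⟨c, hc, rfl⟩ ⟨c', hc', rfl⟩
    exact ⟨c + c', fun i j => Submodule.add_mem _ (hc i j) (hc' i j), rfl⟩
  smul_mem' := by
    rintro a _ ⟨c, hc, rfl⟩
    exact ⟨a • c, fun i j => Submodule.smul_mem _ a (hc i j), rfl⟩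

/-! ### Graded modules: twists, direct sums, isomorphisms -/

/-- The grading of the twist `M(a)`, that is `M(a)ₜ = M_{a+t}`. -/
def twist {k M : Type*} [Field k] [AddCommGroup M] [Module k M] (gr : ℤ → Submodule k M) (a : ℤ) :
    ℤ → Submodule k M :=
  fun t => gr (a + t)

/-- The grading of the direct sum of two graded modules. -/
def sumGrading {k M N : Type*} [Field k] [AddCommGroup M] [Module k M] [AddCommGroup N] [Module k N]
    (gr : ℤ → Submodule k M) (gr' : ℤ → Submodule k N) : ℤ → Submodule k (M × N) :=
  fun t => (gr t).prod (gr' t)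

/-- Isomorphism of graded modules over the coordinate ring: an `R`-linear bijection that identifies,
for every `t`, the graded pieces of degree `t`. -/
def GradedIso {k M N : Type*} [Field k] [AddCommGroup M] [Module k M] [Module (Coord k) M]
    [AddCommGroup N] [Module k N] [Module (Coord k) N]
    (gr : ℤ → Submodule k M) (gr' : ℤ → Submodule k N) : Prop :=
  ∃ e : M ≃ₗ[Coord k] N, ∀ (t : ℤ) (x : M), x ∈ gr t ↔ e x ∈ gr' t

end ProductArrangement

end

open ProductArrangement

/-! Let A, B, I be the ideals attached to F, G and FG: either the radicals or the top-dimensional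
parts of the Jacobian ideals. The proof is liaison addition. It shows I = GA + FB; since F and G are
coprime with F ∈ A and G ∈ B, the sequence 0 → R(-m-p) → A(-p) ⊕ B(-m) → I → 0 with maps c ↦ (Fc,
-Gc) and (a, b) ↦ Ga + Fb is exact. As H¹ and H² of every O(t) on ℙ³ vanish, the second map induces
an isomorphism on H¹ in all degrees.

For I = GA + FB: the minimal primes of J_F are the ideals (L i, L i'), all of height two, so
membership in A is tested on these lines, locally in the case of the top-dimensional part. The lines
of FG are those of F, those of G, and the cross lines L i = M j = 0. Along a line of F the form G is
a unit, so J_FG agrees locally with J_F; along a cross line exactly two factors vanish, so J_FG is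
locally (L i, M j). The cross lines together form the complete intersection (F, G)
(`mem_span_prod_iff`). Thus I = A ∩ B ∩ (F, G), which becomes GA + FB because G is a nonzerodivisor
modulo A and F modulo B (`liaisonSum`).

The long exact sequence is carried out on Čech cochains: `exists_split` and `exists_syzygy` give
exactness on each open set, `exists_cochain₁_of_cocycle` (H² = 0) gives surjectivity, and
`exists_cochain₀_of_cocycle` (H¹ = 0) gives injectivity. Homogeneity of A and B, needed for the
grading, comes from invariance under scaling the variables. -/

noncomputable section
namespace ProductArrangement
open MvPolynomial

/-! ### Ideals generated by linear forms; constant derivations -/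

section LinearForms

variable {k : Type*} [Field k]

/-- A linear form is the linear combination of the variables with its coefficients. -/
theorem mem_span_X_of_isHomogeneous_one {l : Coord k} (hl : l.IsHomogeneous 1) :
    l ∈ Submodule.span k (Set.range (X : Fin 4 → Coord k)) := by
  rw [← homogeneousSubmodule_one_eq_span_X]
  exact hl

/-- Dual functionals of a linearly independent family of linear forms. -/
theorem exists_dual_functional {ι : Type*} [Fintype ι] [DecidableEq ι] {a : ι → Coord k}
    (ha : LinearIndependent k a) :
    ∃ g : Coord k →ₗ[k] (ι → k), ∀ i, g (a i) = Pi.single i 1 := by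
  obtain ⟨g, hg⟩ := LinearMap.exists_leftInverse_of_injective (Fintype.linearCombination k a)
    (LinearMap.ker_eq_bot.mpr ha.fintypeLinearCombination_injective)
  refine ⟨g, fun i => ?_⟩
  have := LinearMap.congr_fun hg (Pi.single i 1)
  simpa [Fintype.linearCombination_apply_single] using this

/-- The ring homomorphism that projects the space of linear forms along the span of `a`. -/
theorem exists_projection {ι : Type*} [Fintype ι] {a : ι → Coord k}
    (ha : LinearIndependent k a) (hh : ∀ i, (a i).IsHomogeneous 1) :
    ∃ φ : Coord k →ₐ[k] Coord k, (∀ f, f - φ f ∈ Ideal.span (Set.range a)) ∧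
      (∀ i, φ (a i) = 0) ∧
      ∀ l : Coord k, l.IsHomogeneous 1 → l - φ l ∈ Submodule.span k (Set.range a) := by
  classical
  obtain ⟨g, hg⟩ := exists_dual_functional ha
  let φ : Coord k →ₐ[k] Coord k := aeval fun i => X i - ∑ j, g (X i) j • a j
  have hlin : ∀ l : Coord k, l.IsHomogeneous 1 → φ l = l - ∑ j, g l j • a j := by
    intro l hl
    refine Submodule.span_induction (p := fun l _ => φ l = l - ∑ j, g l j • a j) ?_ ?_ ?_ ?_
      (mem_span_X_of_isHomogeneous_one hl)
    · rintro _ ⟨i, rfl⟩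
      simp [φ]
    · simp
    · intro x y _ _ hx hy
      rw [map_add, hx, hy, map_add]
      simp only [Pi.add_apply, add_smul, Finset.sum_add_distrib]
      ring
    · intro c x _ hx
      rw [map_smul, hx, map_smul, smul_sub, Finset.smul_sum]
      simp only [Pi.smul_apply, smul_eq_mul, mul_smul]
  refine ⟨φ, fun f => ?_, fun i => ?_, fun l hl => ?_⟩
  · rw [← Ideal.Quotient.mk_eq_mk_iff_sub_mem]
    have : (Ideal.Quotient.mkₐ k (Ideal.span (Set.range a))) =
        (Ideal.Quotient.mkₐ k (Ideal.span (Set.range a))).comp φ := by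
      refine MvPolynomial.algHom_ext fun i => ?_
      simp only [φ, AlgHom.comp_apply, aeval_X, Ideal.Quotient.mkₐ_eq_mk]
      rw [Ideal.Quotient.mk_eq_mk_iff_sub_mem, sub_sub_cancel]
      refine Ideal.sum_mem _ fun j _ => ?_
      rw [Algebra.smul_def]
      exact Ideal.mul_mem_left _ _ (Ideal.subset_span ⟨j, rfl⟩)
    exact DFunLike.congr_fun this f
  · rw [hlin _ (hh i), hg, Finset.sum_eq_single i]
    · simp
    · intro j _ hj
      simp [hj]
    · simp
  · rw [hlin _ hl, sub_sub_cancel]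
    exact Submodule.sum_mem _ fun j _ => Submodule.smul_mem _ _ (Submodule.subset_span ⟨j, rfl⟩)

/-- The projection along the `a i` has exactly this ideal as kernel, and its target is a domain. -/
theorem isPrime_span_range_linearForms {ι : Type*} [Fintype ι] {a : ι → Coord k}
    (ha : LinearIndependent k a) (hh : ∀ i, (a i).IsHomogeneous 1) :
    (Ideal.span (Set.range a)).IsPrime := by
  obtain ⟨φ, h1, h2, -⟩ := exists_projection ha hh
  have hle : Ideal.span (Set.range a) ≤ RingHom.ker φ := by
    rw [Ideal.span_le]
    rintro _ ⟨i, rfl⟩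
    exact h2 i
  have : Ideal.span (Set.range a) = RingHom.ker φ := by
    refine le_antisymm hle fun f hf => ?_
    have := h1 f
    rwa [(RingHom.mem_ker).mp hf, sub_zero] at this
  rw [this]
  exact RingHom.ker_isPrime _

/-- The projection kills the ideal and moves a linear form only by a combination of the `a i`. This
reduces ideal membership of linear forms to linear algebra. -/
theorem mem_span_of_mem_ideal_span {ι : Type*} [Fintype ι] {a : ι → Coord k}
    (ha : LinearIndependent k a) (hh : ∀ i, (a i).IsHomogeneous 1) {l : Coord k}
    (hl : l.IsHomogeneous 1) (h : l ∈ Ideal.span (Set.range a)) :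
    l ∈ Submodule.span k (Set.range a) := by
  obtain ⟨φ, -, h2, h3⟩ := exists_projection ha hh
  have hle : Ideal.span (Set.range a) ≤ RingHom.ker φ := by
    rw [Ideal.span_le]
    rintro _ ⟨i, rfl⟩
    exact h2 i
  have := h3 l hl
  rwa [(RingHom.mem_ker).mp (hle h), sub_zero] at this

theorem range_pair (a b : Coord k) : Set.range ![a, b] = {a, b} := by
  simp [Matrix.range_cons, Set.pair_comm]

theorem isPrime_span_pair {a b : Coord k} (h : LinearIndependent k ![a, b])
    (ha : a.IsHomogeneous 1) (hb : b.IsHomogeneous 1) : (Ideal.span {a, b}).IsPrime := by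
  have := isPrime_span_range_linearForms h (fun i => by fin_cases i <;> assumption)
  rwa [range_pair] at this

theorem isPrime_span_singleton {a : Coord k} (h : a ≠ 0) (ha : a.IsHomogeneous 1) :
    (Ideal.span {a}).IsPrime := by
  have := isPrime_span_range_linearForms (a := fun _ : Unit => a)
    (linearIndependent_unique_iff.mpr h) (fun _ => ha)
  rwa [Set.range_const] at this

theorem exists_coeff_of_mem_span_pair {a b l : Coord k} (h : LinearIndependent k ![a, b])
    (ha : a.IsHomogeneous 1) (hb : b.IsHomogeneous 1) (hl : l.IsHomogeneous 1)
    (hm : l ∈ Ideal.span {a, b}) : ∃ c d : k, c • a + d • b = l := by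
  have := mem_span_of_mem_ideal_span h (fun i => by fin_cases i <;> assumption) hl
    (by rwa [range_pair])
  rwa [range_pair, Submodule.mem_span_pair] at this

theorem exists_coeff_of_mem_span_singleton {a l : Coord k} (h : a ≠ 0)
    (ha : a.IsHomogeneous 1) (hl : l.IsHomogeneous 1)
    (hm : l ∈ Ideal.span {a}) : ∃ c : k, c • a = l := by
  have := mem_span_of_mem_ideal_span (a := fun _ : Unit => a)
    (linearIndependent_unique_iff.mpr h) (fun _ => ha) hl (by rwa [Set.range_const])
  rwa [Set.range_const, Submodule.mem_span_singleton] at this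

/-- Exchange: a third linear form in the span of two, not proportional to the first one,
spans together with the first one a space containing the second one. -/
theorem mem_span_pair_exchange {a b l : Coord k} (h : LinearIndependent k ![a, b])
    (hal : LinearIndependent k ![a, l])
    (ha : a.IsHomogeneous 1) (hb : b.IsHomogeneous 1) (hl : l.IsHomogeneous 1)
    (hm : l ∈ Ideal.span {a, b}) : b ∈ Ideal.span {a, l} := by
  obtain ⟨c, d, rfl⟩ := exists_coeff_of_mem_span_pair h ha hb hl hm
  have hd : d ≠ 0 := by
    rintro rfl
    rw [LinearIndependent.pair_iff] at hal
    have := (hal (-c) 1 (by simp)).2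
    exact one_ne_zero this
  rw [Ideal.mem_span_pair]
  refine ⟨-C (d⁻¹ * c), C d⁻¹, ?_⟩
  rw [smul_eq_C_mul, smul_eq_C_mul, C_mul]
  have : (C d⁻¹ * C d : Coord k) = 1 := by rw [← C_mul, inv_mul_cancel₀ hd, C_1]
  linear_combination b * this

theorem not_mem_span_singleton_of_linearIndependent {a b : Coord k}
    (h : LinearIndependent k ![a, b])
    (ha : a.IsHomogeneous 1) (hb : b.IsHomogeneous 1) : b ∉ Ideal.span {a} := by
  intro hm
  have ha0 : a ≠ 0 := h.ne_zero 0
  obtain ⟨c, rfl⟩ := exists_coeff_of_mem_span_singleton ha0 ha hb hm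
  rw [LinearIndependent.pair_iff] at h
  exact one_ne_zero (h (-c) 1 (by simp)).2

theorem linearIndependent_pair_swap {a b : Coord k}
    (h : LinearIndependent k ![a, b]) : LinearIndependent k ![b, a] := by
  rw [LinearIndependent.pair_iff] at h ⊢
  intro s t hst
  exact (h t s (by rw [add_comm, hst])).symm

/-- Krull's height theorem bounds the height above; the chain of primes 0 < (a) < (a, b) bounds it
below. -/
theorem height_span_pair {a b : Coord k} (h : LinearIndependent k ![a, b])
    (ha : a.IsHomogeneous 1) (hb : b.IsHomogeneous 1) : (Ideal.span {a, b}).height = 2 := by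
  have hp := isPrime_span_pair h ha hb
  have ha0 : a ≠ 0 := h.ne_zero 0
  have hp1 := isPrime_span_singleton ha0 ha
  apply le_antisymm
  · have := Ideal.height_le_card_of_mem_minimalPrimes_span (p := Ideal.span {a, b}) (s := {a, b})
      (Set.toFinite _) (by rw [Ideal.minimalPrimes_eq_subsingleton_self]; rfl)
    refine this.trans ?_
    exact_mod_cast Set.ncard_insert_le a {b} |>.trans (by simp)
  · have h1 : (⊥ : Ideal (Coord k)) < Ideal.span {a} := by
      rw [bot_lt_iff_ne_bot, Ne, Ideal.span_singleton_eq_bot]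
      exact ha0
    have h2 : Ideal.span {a} < Ideal.span {a, b} := by
      refine lt_of_le_of_ne (Ideal.span_mono (by simp)) fun he => ?_
      refine not_mem_span_singleton_of_linearIndependent h ha hb ?_
      rw [he]
      exact Ideal.subset_span (by simp)
    have e1 := Ideal.height_add_one_le_of_lt_of_isPrime h1
    have e2 := Ideal.height_add_one_le_of_lt_of_isPrime h2
    calc (2 : ℕ∞) = 0 + 1 + 1 := by norm_num
      _ ≤ (⊥ : Ideal (Coord k)).height + 1 + 1 := by gcongr; exact zero_le
      _ ≤ (Ideal.span {a}).height + 1 := by gcongr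
      _ ≤ _ := e2

/-- Every `k`-linear functional on linear forms is a derivation of the polynomial ring. -/
theorem exists_derivation (α : Coord k →ₗ[k] k) :
    ∃ D : Derivation k (Coord k) (Coord k), ∀ l : Coord k, l.IsHomogeneous 1 → D l = C (α l) := by
  refine ⟨mkDerivation k fun i => C (α (X i)), fun l hl => ?_⟩
  refine Submodule.span_induction
    (p := fun l _ => mkDerivation k (fun i => C (α (X i))) l = C (α l)) ?_ ?_ ?_ ?_
    (mem_span_X_of_isHomogeneous_one hl)
  · rintro _ ⟨i, rfl⟩
    simp
  · simp
  · intro x y _ _ hx hy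
    rw [map_add, hx, hy, map_add, C_add]
  · intro c x _ hx
    rw [Derivation.map_smul, hx, map_smul, smul_eq_C_mul, smul_eq_mul, C_mul]

theorem exists_derivation_pair {a b : Coord k} (h : LinearIndependent k ![a, b])
    (ha : a.IsHomogeneous 1) (hb : b.IsHomogeneous 1) :
    ∃ D : Derivation k (Coord k) (Coord k), D a = 1 ∧ D b = 0 := by
  obtain ⟨g, hg⟩ := exists_dual_functional h
  obtain ⟨D, hD⟩ := exists_derivation (LinearMap.proj 0 ∘ₗ g)
  refine ⟨D, ?_, ?_⟩
  · rw [hD a ha]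
    have := hg 0
    simp only [Matrix.cons_val_zero] at this
    simp [this]
  · rw [hD b hb]
    have : g b = Pi.single 1 1 := hg 1
    simp [this]

theorem exists_derivation_one {a : Coord k} (h : a ≠ 0) (ha : a.IsHomogeneous 1) :
    ∃ D : Derivation k (Coord k) (Coord k), D a = 1 := by
  obtain ⟨g, hg⟩ := exists_dual_functional (a := fun _ : Unit => a)
    (linearIndependent_unique_iff.mpr h)
  obtain ⟨D, hD⟩ := exists_derivation (LinearMap.proj () ∘ₗ g)
  refine ⟨D, ?_⟩
  rw [hD a ha]
  simp [hg ()]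

end LinearForms

/-! ### Local description of the top-dimensional part -/

section TopDimensional

variable {k : Type*} [Field k]

/-- If all minimal primes of `J` have height two, the top-dimensional part of `J` consists of the
elements that lie in `J` locally at every minimal prime of `J`. -/
theorem IsTopDimensionalPart.mem_iff {J Q : Ideal (Coord k)} (h : IsTopDimensionalPart J Q)
    (hJ : ∀ P ∈ J.minimalPrimes, P.height = 2) (f : Coord k) :
    f ∈ Q ↔ ∀ P ∈ J.minimalPrimes, ∃ s ∉ P, s * f ∈ J := by
  classical
  obtain ⟨t, ht, rfl⟩ := h
  have hJle : ∀ q ∈ t, J ≤ q := fun q hq => by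
    rw [← ht.inf_eq]
    exact Finset.inf_le (f := id) hq
  have hmin : ∀ q ∈ t, ∀ P ∈ J.minimalPrimes, q ≤ P → q.radical = P := fun q hq P hP hqP => by
    have hprime := Ideal.isPrime_radical (ht.primary hq)
    have hle : q.radical ≤ P := (hP.1.1.radical_le_iff).mpr hqP
    exact le_antisymm hle (hP.2 ⟨hprime, (hJle q hq).trans Ideal.le_radical⟩ hle)
  simp only [Set.mem_ofPred_eq, Ideal.mem_iInf, and_imp]
  constructor
  · intro hf P hP
    have hPp : P.IsPrime := hP.1.1
    -- A component inside `P` has radical `P`, hence height two, and contains `f`; any other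
    -- component contains an element outside `P`. The product of these multipliers works for all
    -- components at once.
    have hs : ∀ q : Ideal (Coord k), ∃ s : Coord k, s ∉ P ∧ (q ∈ t → s * f ∈ q) := by
      intro q
      by_cases hq : q ∈ t
      · by_cases hqP : q ≤ P
        · have hr := hmin q hq P hP hqP
          refine ⟨1, (Ideal.ne_top_iff_one P).mp hPp.ne_top, fun _ => ?_⟩
          rw [one_mul]
          refine hf q hq ?_
          rw [← hJ P hP, ← hr]
          rw [Ideal.height_eq_inf_minimalPrimes, Ideal.height_eq_inf_minimalPrimes,
            Ideal.radical_minimalPrimes]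
        · obtain ⟨s, hsq, hsP⟩ := Set.not_subset.mp hqP
          exact ⟨s, hsP, fun _ => Ideal.mul_mem_right _ _ hsq⟩
      · exact ⟨1, (Ideal.ne_top_iff_one P).mp hPp.ne_top, fun h => absurd h hq⟩
    choose s hsP hsq using hs
    refine ⟨∏ q ∈ t, s q, fun hmem => ?_, ?_⟩
    · obtain ⟨q, -, hq⟩ := (hPp.prod_mem_iff).mp hmem
      exact hsP q hq
    · rw [← ht.inf_eq, Submodule.mem_finsetInf]
      intro q hq
      rw [← Finset.mul_prod_erase t s hq, mul_right_comm]
      exact Ideal.mul_mem_right _ _ (hsq q hq)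
  · intro hf q hq hq2
    have hprime := Ideal.isPrime_radical (ht.primary hq)
    obtain ⟨P, hP, hPle⟩ := Ideal.exists_minimalPrimes_le ((hJle q hq).trans Ideal.le_radical)
    have hPp : P.IsPrime := hP.1.1
    have hheight : q.radical.height = 2 := by
      rw [← hq2, Ideal.height_eq_inf_minimalPrimes, Ideal.height_eq_inf_minimalPrimes,
        Ideal.radical_minimalPrimes]
    -- Nested primes of the same finite height coincide, so `s` lies outside `q.radical` and can be
    -- cancelled in the primary ideal `q`.
    have : P = q.radical := by
      by_contra hne
      have h1 := Ideal.height_add_one_le_of_lt_of_isPrime (lt_of_le_of_ne hPle hne)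
      rw [hJ P hP, hheight] at h1
      exact absurd h1 (by decide)
    obtain ⟨s, hs, hsf⟩ := hf P hP
    rw [this] at hs
    have := (Ideal.isPrimary_iff.mp (ht.primary hq)).2 (x := f) (y := s)
      (by rw [mul_comm]; exact hJle q hq hsf)
    exact this.resolve_right hs

end TopDimensional

/-! ### Jacobian ideals of products -/

section Jacobian

variable {k : Type*} [Field k]

/-- Every derivation is a combination of the partial derivatives. This frees the Jacobian ideal from
coordinates, so that derivations adapted to given linear forms can be used. -/
theorem derivation_mem_jacobianIdeal (D : Derivation k (Coord k) (Coord k)) (F : Coord k) :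
    D F ∈ jacobianIdeal F := by
  have hsum : ∀ f, (∑ i, D (X i) • pderiv i : Derivation k (Coord k) (Coord k)) f =
      ∑ i, D (X i) * pderiv i f := fun f => by
    rw [← Derivation.coeFnAddMonoidHom_apply, map_sum, Finset.sum_apply]
    rfl
  have : D = ∑ i, D (X i) • pderiv i := by
    refine derivation_ext fun j => ?_
    rw [hsum, Finset.sum_eq_single j]
    · simp
    · intro i _ hij
      simp [pderiv_X_of_ne hij.symm]
    · simp
  rw [this, hsum]
  exact Ideal.sum_mem _ fun i _ => Ideal.mul_mem_left _ _ (Ideal.subset_span ⟨i, rfl⟩)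

theorem jacobianIdeal_le_iff {F : Coord k} {I : Ideal (Coord k)} :
    jacobianIdeal F ≤ I ↔ ∀ D : Derivation k (Coord k) (Coord k), D F ∈ I := by
  constructor
  · intro h D
    exact h (derivation_mem_jacobianIdeal D F)
  · intro h
    rw [jacobianIdeal, Ideal.span_le]
    rintro _ ⟨i, rfl⟩
    exact h (pderiv i)

/-- Euler's relation, divided by the degree. -/
theorem self_mem_jacobianIdeal [CharZero k] {F : Coord k} {n : ℕ} (hF : F.IsHomogeneous n)
    (hn : n ≠ 0) : F ∈ jacobianIdeal F := by
  have h := hF.sum_X_mul_pderiv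
  have hmem : (n • F) ∈ jacobianIdeal F := by
    rw [← h]
    exact Ideal.sum_mem _ fun i _ => Ideal.mul_mem_left _ _ (Ideal.subset_span ⟨i, rfl⟩)
  have hn' : (n : k) ≠ 0 := Nat.cast_ne_zero.mpr hn
  have : C (n : k)⁻¹ * (n • F) = F := by
    rw [nsmul_eq_mul, ← mul_assoc, ← map_natCast (C : k →+* Coord k), ← C_mul,
      inv_mul_cancel₀ hn', C_1, one_mul]
  have h' := Ideal.mul_mem_left _ (C (n : k)⁻¹) hmem
  rwa [this] at h'

theorem jacobianIdeal_mul_le {F G : Coord k} (hF : F ∈ jacobianIdeal F) :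
    jacobianIdeal (F * G) ≤ jacobianIdeal F := by
  rw [jacobianIdeal_le_iff]
  intro D
  rw [Derivation.leibniz]
  exact Ideal.add_mem _ (Ideal.mul_mem_right _ _ hF)
    (Ideal.mul_mem_left _ _ (derivation_mem_jacobianIdeal D F))

/-- The identity G² D(F) = G D(FG) - D(G) FG. With `jacobianIdeal_mul_le`, it shows that the two
Jacobian ideals agree wherever G is invertible. -/
theorem sq_mul_mem_jacobianIdeal_mul {F G f : Coord k} (hFG : F * G ∈ jacobianIdeal (F * G))
    (hf : f ∈ jacobianIdeal F) : G ^ 2 * f ∈ jacobianIdeal (F * G) := by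
  have hle : jacobianIdeal F ≤ Submodule.comap
      (LinearMap.mulLeft (Coord k) (G ^ 2)) (jacobianIdeal (F * G)) := by
    rw [jacobianIdeal_le_iff]
    intro D
    have h1 := derivation_mem_jacobianIdeal D (F * G)
    have h2 := Ideal.sub_mem _ (Ideal.mul_mem_left _ G h1) (Ideal.mul_mem_left _ (D G) hFG)
    have : G ^ 2 * D F = G * D (F * G) - D G * (F * G) := by
      rw [Derivation.leibniz, smul_eq_mul, smul_eq_mul]
      ring
    change G ^ 2 * D F ∈ jacobianIdeal (F * G)
    rwa [this]
  exact hle hf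

/-- Where exactly two of the factors vanish, the singular locus is reduced. -/
theorem sq_mul_mem_jacobianIdeal_of_mem_span_pair {a b H f : Coord k}
    (h : LinearIndependent k ![a, b])
    (ha : a.IsHomogeneous 1) (hb : b.IsHomogeneous 1)
    (hself : a * b * H ∈ jacobianIdeal (a * b * H)) (hf : f ∈ Ideal.span {a, b}) :
    H ^ 2 * f ∈ jacobianIdeal (a * b * H) := by
  obtain ⟨D, hDa, hDb⟩ := exists_derivation_pair h ha hb
  obtain ⟨E, hEb, hEa⟩ := exists_derivation_pair (linearIndependent_pair_swap h) hb ha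
  -- As D(a) = 1 and D(b) = 0, this element equals H² b; the one built from `E` equals H² a.
  have h1 := Ideal.sub_mem _ (Ideal.mul_mem_left _ H (derivation_mem_jacobianIdeal D (a * b * H)))
    (Ideal.mul_mem_left _ (D H) hself)
  have h2 := Ideal.sub_mem _ (Ideal.mul_mem_left _ H (derivation_mem_jacobianIdeal E (a * b * H)))
    (Ideal.mul_mem_left _ (E H) hself)
  obtain ⟨u, v, rfl⟩ := Ideal.mem_span_pair.mp hf
  have h3 := Ideal.add_mem _ (Ideal.mul_mem_left _ v h1) (Ideal.mul_mem_left _ u h2)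
  convert h3 using 1
  simp only [Derivation.leibniz, smul_eq_mul, hDa, hDb, hEa, hEb]
  ring

end Jacobian

/-! ### Minimal primes for a product of linear forms -/

section Products

variable {k : Type*} [Field k] {ι : Type*} [Fintype ι] {L : ι → Coord k}

theorem isHomogeneous_prod (hL : ∀ i, (L i).IsHomogeneous 1) :
    (∏ i, L i).IsHomogeneous (Fintype.card ι) := by
  have := IsHomogeneous.prod Finset.univ L (fun _ => 1) fun i _ => hL i
  simpa using this

theorem prod_mem_jacobianIdeal [CharZero k] [Nonempty ι] (hL : ∀ i, (L i).IsHomogeneous 1) :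
    ∏ i, L i ∈ jacobianIdeal (∏ i, L i) :=
  self_mem_jacobianIdeal (isHomogeneous_prod hL) Fintype.card_ne_zero

/-- By Euler some factor `L i` lies in `P`; a derivation with value 1 on `L i` then forces the
product of the remaining factors into `P`. The converse is the product rule. -/
theorem jacobianIdeal_prod_le_iff [CharZero k] [Nonempty ι] (hL : ∀ i, (L i).IsHomogeneous 1)
    (hL0 : ∀ i, L i ≠ 0) {P : Ideal (Coord k)} (hP : P.IsPrime) :
    jacobianIdeal (∏ i, L i) ≤ P ↔ ∃ i j, i ≠ j ∧ L i ∈ P ∧ L j ∈ P := by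
  classical
  constructor
  · intro h
    obtain ⟨i, -, hi⟩ := (hP.prod_mem_iff).mp (h (prod_mem_jacobianIdeal hL))
    obtain ⟨D, hD⟩ := exists_derivation_one (hL0 i) (hL i)
    have h1 := h (derivation_mem_jacobianIdeal D (∏ i, L i))
    rw [← Finset.mul_prod_erase _ L (Finset.mem_univ i), Derivation.leibniz, hD, smul_eq_mul,
      smul_eq_mul, mul_one] at h1
    have h2 := (Ideal.add_mem_iff_right _ (Ideal.mul_mem_right _ _ hi)).mp h1
    obtain ⟨j, hj, hj'⟩ := (hP.prod_mem_iff).mp h2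
    exact ⟨i, j, (Finset.ne_of_mem_erase hj).symm, hi, hj'⟩
  · rintro ⟨i, j, hij, hi, hj⟩
    rw [jacobianIdeal_le_iff]
    intro D
    rw [← Finset.mul_prod_erase _ L (Finset.mem_univ i),
      ← Finset.mul_prod_erase _ L (Finset.mem_erase.mpr ⟨hij.symm, Finset.mem_univ j⟩),
      Derivation.leibniz, smul_eq_mul, smul_eq_mul]
    exact Ideal.add_mem _ (Ideal.mul_mem_right _ _ hi)
      (Ideal.mul_mem_right _ _ (Ideal.mul_mem_right _ _ hj))

/-- A prime containing the Jacobian ideal contains two of the factors, hence one of these primes;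
they all have height two, so none properly contains another. -/
theorem mem_minimalPrimes_jacobianIdeal_prod [CharZero k] [Nonempty ι]
    (hL : ∀ i, (L i).IsHomogeneous 1)
    (hL0 : ∀ i, L i ≠ 0) (hind : Pairwise fun i j => LinearIndependent k ![L i, L j])
    (P : Ideal (Coord k)) :
    P ∈ (jacobianIdeal (∏ i, L i)).minimalPrimes ↔
      ∃ i j, i ≠ j ∧ P = Ideal.span {L i, L j} := by
  have hsub : ∀ i j, i ≠ j → jacobianIdeal (∏ i, L i) ≤ Ideal.span {L i, L j} := fun i j hij =>
    (jacobianIdeal_prod_le_iff hL hL0 (isPrime_span_pair (hind hij) (hL i) (hL j))).mpr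
      ⟨i, j, hij, Ideal.subset_span (by simp), Ideal.subset_span (by simp)⟩
  have hle : ∀ (P : Ideal (Coord k)) (i j), L i ∈ P → L j ∈ P → Ideal.span {L i, L j} ≤ P := by
    intro P i j hi hj
    rw [Ideal.span_le]
    rintro x (rfl | rfl) <;> assumption
  constructor
  · intro hP
    obtain ⟨i, j, hij, hi, hj⟩ := (jacobianIdeal_prod_le_iff hL hL0 hP.1.1).mp hP.1.2
    refine ⟨i, j, hij, le_antisymm ?_ (hle P i j hi hj)⟩
    exact hP.2 ⟨isPrime_span_pair (hind hij) (hL i) (hL j), hsub i j hij⟩ (hle P i j hi hj)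
  · rintro ⟨i, j, hij, rfl⟩
    have hp := isPrime_span_pair (hind hij) (hL i) (hL j)
    refine ⟨⟨hp, hsub i j hij⟩, ?_⟩
    rintro Q ⟨hQ, hJQ⟩ hQP
    obtain ⟨i', j', hij', hi, hj⟩ := (jacobianIdeal_prod_le_iff hL hL0 hQ).mp hJQ
    have hp' := isPrime_span_pair (hind hij') (hL i') (hL j')
    have h1 := hle Q i' j' hi hj
    have : Ideal.span {L i', L j'} = Ideal.span {L i, L j} := by
      by_contra hne
      have h2 := Ideal.height_add_one_le_of_lt_of_isPrime (lt_of_le_of_ne (h1.trans hQP) hne)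
      rw [height_span_pair (hind hij) (hL i) (hL j),
        height_span_pair (hind hij') (hL i') (hL j')] at h2
      exact absurd h2 (by decide)
    rw [← this]
    exact h1

theorem mem_radical_jacobianIdeal_prod [CharZero k] [Nonempty ι]
    (hL : ∀ i, (L i).IsHomogeneous 1)
    (hL0 : ∀ i, L i ≠ 0) (hind : Pairwise fun i j => LinearIndependent k ![L i, L j])
    (f : Coord k) :
    f ∈ (jacobianIdeal (∏ i, L i)).radical ↔ ∀ i j, i ≠ j → f ∈ Ideal.span {L i, L j} := by
  rw [← Ideal.sInf_minimalPrimes, Ideal.mem_sInf]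
  simp only [mem_minimalPrimes_jacobianIdeal_prod hL hL0 hind]
  constructor
  · intro h i j hij
    exact h ⟨i, j, hij, rfl⟩
  · rintro h _ ⟨i, j, hij, rfl⟩
    exact h i j hij

theorem IsTopDimensionalPart.mem_iff_of_prod [CharZero k] [Nonempty ι]
    (hL : ∀ i, (L i).IsHomogeneous 1)
    (hL0 : ∀ i, L i ≠ 0) (hind : Pairwise fun i j => LinearIndependent k ![L i, L j])
    {Q : Ideal (Coord k)} (hQ : IsTopDimensionalPart (jacobianIdeal (∏ i, L i)) Q)
    (f : Coord k) :
    f ∈ Q ↔ ∀ i j, i ≠ j → ∃ s ∉ Ideal.span {L i, L j}, s * f ∈ jacobianIdeal (∏ i, L i) := by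
  rw [hQ.mem_iff]
  · simp only [mem_minimalPrimes_jacobianIdeal_prod hL hL0 hind]
    constructor
    · intro h i j hij
      exact h _ ⟨i, j, hij, rfl⟩
    · rintro h _ ⟨i, j, hij, rfl⟩
      exact h i j hij
  · intro P hP
    obtain ⟨i, j, hij, rfl⟩ := (mem_minimalPrimes_jacobianIdeal_prod hL hL0 hind P).mp hP
    exact height_span_pair (hind hij) (hL i) (hL j)

end Products

/-! ### Homogeneity of ideals through scaling -/

section Homogeneity

variable {k : Type*} [Field k]

/-- The substitution `xᵢ ↦ c xᵢ`. -/
def scaling (c : k) : Coord k →ₐ[k] Coord k := aeval fun i => C c * X i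

theorem scaling_of_isHomogeneous (c : k) {f : Coord k} {n : ℕ} (hf : f.IsHomogeneous n) :
    scaling c f = C (c ^ n) * f := by
  rw [f.as_sum, map_sum, Finset.mul_sum]
  refine Finset.sum_congr rfl fun d hd => ?_
  have hdeg : d.degree = n := by
    by_contra h
    exact (mem_support_iff.mp hd) (hf.coeff_eq_zero h)
  rw [scaling, aeval_monomial, monomial_eq, Finsupp.prod, Finsupp.prod]
  simp only [mul_pow, Finset.prod_mul_distrib]
  rw [Finset.prod_pow_eq_pow_sum, ← hdeg, Finsupp.degree, C_pow, algebraMap_eq]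
  ring_nf
  rfl

theorem scaling_scaling {c d : k} (h : c * d = 1) (f : Coord k) : scaling c (scaling d f) = f := by
  have : (scaling c).comp (scaling d) = AlgHom.id k (Coord k) := by
    refine MvPolynomial.algHom_ext fun i => ?_
    simp only [scaling, AlgHom.comp_apply, aeval_X, map_mul, AlgHom.id_apply]
    rw [← algebraMap_eq, AlgHom.commutes, algebraMap_eq, ← mul_assoc, ← C_mul, mul_comm d c, h,
      C_1, one_mul]
  exact DFunLike.congr_fun this f

theorem scaling_mem_span {c : k} {S : Set (Coord k)} (hS : ∀ g ∈ S, ∃ n, g.IsHomogeneous n)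
    {f : Coord k} (hf : f ∈ Ideal.span S) : scaling c f ∈ Ideal.span S := by
  have : Ideal.span S ≤ (Ideal.span S).comap (scaling c) := by
    rw [Ideal.span_le]
    intro g hg
    obtain ⟨n, hn⟩ := hS g hg
    change scaling c g ∈ Ideal.span S
    rw [scaling_of_isHomogeneous c hn]
    exact Ideal.mul_mem_left _ _ (Ideal.subset_span hg)
  exact this hf

/-- A Vandermonde argument: in characteristic zero the numbers 2 ^ d are distinct, so the summands
are recovered from the power-weighted sums by elimination. -/
theorem mem_of_forall_sum_pow_mem [CharZero k] {K : Ideal (Coord k)} (s : Finset ℕ) :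
    ∀ g : ℕ → Coord k, (∀ n : ℕ, ∑ d ∈ s, C ((2 ^ d) ^ n : k) * g d ∈ K) → ∀ d ∈ s, g d ∈ K := by
  induction s using Finset.induction_on with
  | empty => simp
  | insert a s ha ih =>
    intro g hg
    have hs : ∀ d ∈ s, g d ∈ K := by
      intro d hd
      have h1 := ih (fun d => C (2 ^ d - 2 ^ a : k) * g d) (fun n => by
        -- Subtracting 2 ^ a times relation n from relation n + 1 removes the summand at `a` and
        -- multiplies the one at `d` by the nonzero scalar 2 ^ d - 2 ^ a.
        have h2 := Ideal.sub_mem _ (hg (n + 1)) (Ideal.mul_mem_left _ (C (2 ^ a : k)) (hg n))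
        convert h2 using 1
        rw [Finset.sum_insert ha, Finset.sum_insert ha, mul_add, Finset.mul_sum, add_sub_add_comm,
          ← Finset.sum_sub_distrib, ← mul_assoc, ← C_mul, ← pow_succ', sub_self, zero_add]
        refine Finset.sum_congr rfl fun d _ => ?_
        simp only [C_sub, C_pow]
        ring) d hd
      have hne : (2 ^ d - 2 ^ a : k) ≠ 0 := by
        rw [sub_ne_zero]
        intro h
        have : (2 ^ d : ℕ) = 2 ^ a := by exact_mod_cast h
        have := Nat.pow_right_injective le_rfl this
        exact ha (this ▸ hd)
      have h3 := Ideal.mul_mem_left _ (C (2 ^ d - 2 ^ a : k)⁻¹) h1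
      rwa [← mul_assoc, ← C_mul, inv_mul_cancel₀ hne, C_1, one_mul] at h3
    intro d hd
    rcases Finset.mem_insert.mp hd with rfl | hd
    · have h0 := hg 0
      rw [Finset.sum_insert ha] at h0
      have := (Ideal.add_mem_iff_left _ (Ideal.sum_mem _ fun e he =>
        Ideal.mul_mem_left _ _ (hs e he))).mp h0
      simpa using this
    · exact hs d hd

/-- An ideal that is invariant under `xᵢ ↦ 2xᵢ` is homogeneous. -/
theorem homogeneousComponent_mem_of_scaling [CharZero k] {K : Ideal (Coord k)}
    (hK : ∀ f ∈ K, scaling 2 f ∈ K) {f : Coord k} (hf : f ∈ K) (d : ℕ) :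
    homogeneousComponent d f ∈ K := by
  by_cases hd : d ∈ Finset.range (f.totalDegree + 1)
  · refine mem_of_forall_sum_pow_mem (Finset.range (f.totalDegree + 1))
      (fun d => homogeneousComponent d f) (fun n => ?_) d hd
    have h1 : ∀ n, ((scaling (2 : k))^[n]) f ∈ K := by
      intro n
      induction n with
      | zero => exact hf
      | succ n ih =>
        rw [Function.iterate_succ_apply']
        exact hK _ ih
    convert h1 n using 1
    induction n with
    | zero => simpa using sum_homogeneousComponent f
    | succ n ih =>
      rw [Function.iterate_succ_apply', ← ih, map_sum]
      refine Finset.sum_congr rfl fun d _ => ?_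
      have hhom : (C ((2 ^ d) ^ n : k) * homogeneousComponent d f).IsHomogeneous d :=
        (homogeneousComponent_isHomogeneous d f).C_mul _
      rw [scaling_of_isHomogeneous 2 hhom, ← mul_assoc, ← C_mul, pow_succ']
  · have hlt : f.totalDegree < d := by
      rw [Finset.mem_range] at hd
      omega
    rw [homogeneousComponent_eq_zero d f hlt]
    exact Submodule.zero_mem K

theorem scaling_mem_radical {c : k} {J : Ideal (Coord k)} (hJ : ∀ f ∈ J, scaling c f ∈ J)
    {f : Coord k} (hf : f ∈ J.radical) : scaling c f ∈ J.radical := by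
  obtain ⟨n, hn⟩ := hf
  exact ⟨n, by rw [← map_pow]; exact hJ _ hn⟩

theorem scaling_mem_jacobianIdeal {c : k} {F : Coord k} {n : ℕ} (hF : F.IsHomogeneous n)
    {f : Coord k} (hf : f ∈ jacobianIdeal F) : scaling c f ∈ jacobianIdeal F := by
  refine scaling_mem_span ?_ hf
  rintro _ ⟨i, rfl⟩
  exact ⟨n - 1, hF.pderiv⟩

theorem scaling_notMem_span_pair {c d : k} (hcd : c * d = 1) {a b : Coord k}
    (ha : a.IsHomogeneous 1) (hb : b.IsHomogeneous 1)
    {s : Coord k} (hs : s ∉ Ideal.span {a, b}) : scaling d s ∉ Ideal.span {a, b} := by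
  intro h
  apply hs
  rw [← scaling_scaling hcd s]
  refine scaling_mem_span ?_ h
  rintro g (rfl | rfl)
  exacts [⟨1, ha⟩, ⟨1, hb⟩]

end Homogeneity

/-! ### Degrees of fractions and of polynomials -/

section Degree

attribute [local instance] MvPolynomial.gradedAlgebra

variable {k : Type*} [Field k]

theorem coe_decompose_eq_homogeneousComponent (f : Coord k) (d : ℕ) :
    (DirectSum.decompose (homogeneousSubmodule (Fin 4) k) f d : Coord k) =
      homogeneousComponent d f :=
  decomposition.decompose'_apply f d

theorem homogeneousComponent_add_mul {b : Coord k} {e : ℕ} (hb : b.IsHomogeneous e) (c : Coord k)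
    (d : ℕ) : homogeneousComponent (e + d) (b * c) = b * homogeneousComponent d c := by
  have := DirectSum.coe_decompose_mul_add_of_left_mem (homogeneousSubmodule (Fin 4) k) (i := e)
    (j := d) (a := b) (b := c) hb
  rwa [coe_decompose_eq_homogeneousComponent, coe_decompose_eq_homogeneousComponent] at this

theorem homogeneousComponent_mul_of_lt {b : Coord k} {e : ℕ} (hb : b.IsHomogeneous e) (c : Coord k)
    {d : ℕ} (hd : d < e) : homogeneousComponent d (b * c) = 0 := by
  have := DirectSum.coe_decompose_mul_of_left_mem_of_not_le (homogeneousSubmodule (Fin 4) k)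
    (i := e) (n := d) (a := b) (b := c) hb (by omega)
  rwa [coe_decompose_eq_homogeneousComponent] at this

theorem isHomogeneous_of_mul {b c : Coord k} {e d : ℕ} (hb : b.IsHomogeneous e) (hb0 : b ≠ 0)
    (hbc : (b * c).IsHomogeneous (e + d)) : c.IsHomogeneous d := by
  have h := homogeneousComponent_add_mul hb c d
  rw [homogeneousComponent_eq_self hbc] at h
  rw [mul_left_cancel₀ hb0 h]
  exact homogeneousComponent_isHomogeneous d c

theorem algebraMap_mem_fractionsOfDegree {c : Coord k} {d : ℕ} (hc : c.IsHomogeneous d) :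
    algebraMap (Coord k) (Frac k) c ∈ fractionsOfDegree k d :=
  ⟨d, 0, c, 1, hc, isHomogeneous_one _ _, one_ne_zero, by simp, by simp⟩

theorem isHomogeneous_of_algebraMap_mem {c : Coord k} {d : ℕ}
    (hc : algebraMap (Coord k) (Frac k) c ∈ fractionsOfDegree k d) : c.IsHomogeneous d := by
  obtain ⟨d', e, a, b, ha, hb, hb0, ht, h⟩ := hc
  rw [← map_mul] at h
  have h' := IsFractionRing.injective (Coord k) (Frac k) h
  have : d' = e + d := by omega
  subst this
  exact isHomogeneous_of_mul hb hb0 (h' ▸ ha)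

theorem eq_zero_of_algebraMap_mem_of_neg {c : Coord k} {t : ℤ} (ht : t < 0)
    (hc : algebraMap (Coord k) (Frac k) c ∈ fractionsOfDegree k t) : c = 0 := by
  obtain ⟨d, e, a, b, ha, hb, hb0, hde, h⟩ := hc
  rw [← map_mul] at h
  have h' := IsFractionRing.injective (Coord k) (Frac k) h
  have h1 := homogeneousComponent_mul_of_lt hb c (d := d) (by omega)
  rw [h', homogeneousComponent_eq_self ha] at h1
  rw [h1] at h'
  exact (mul_eq_zero.mp h').resolve_left hb0

theorem algebraMap_mul_mem_fractionsOfDegree {b : Coord k} {e : ℕ} (hb : b.IsHomogeneous e)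
    {g : Frac k} {t s : ℤ} (hg : g ∈ fractionsOfDegree k t) (hs : s = t + e) :
    algebraMap (Coord k) (Frac k) b * g ∈ fractionsOfDegree k s := by
  obtain ⟨d, e', a, b', ha, hb', hb0, ht, h⟩ := hg
  refine ⟨e + d, e', b * a, b', hb.mul ha, hb', hb0, by push_cast; omega, ?_⟩
  rw [map_mul, ← h]
  ring

theorem mem_fractionsOfDegree_of_algebraMap_mul {b : Coord k} {e : ℕ} (hb : b.IsHomogeneous e)
    (hb0 : b ≠ 0) {g : Frac k} {t s : ℤ} (hs : s = t + e)
    (hg : algebraMap (Coord k) (Frac k) b * g ∈ fractionsOfDegree k s) :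
    g ∈ fractionsOfDegree k t := by
  obtain ⟨d, e', a, b', ha, hb', hb0', ht, h⟩ := hg
  refine ⟨d, e' + e, a, b' * b, ha, hb'.mul hb, mul_ne_zero hb0' hb0, by push_cast; omega, ?_⟩
  rw [map_mul, ← h]
  ring

end Degree

/-! ### Monomialwise selection, the contraction behind Čech vanishing -/

section Selection

variable {k : Type*} [Field k]

/-- The polynomial whose coefficient at `e` is the coefficient of `f (s e)` at `e`. -/
def mix (s : (Fin 4 →₀ ℕ) → Fin 4) (f : Fin 4 → Coord k) : Coord k :=
  ∑ v, ∑ e ∈ (f v).support with s e = v, monomial e (coeff e (f v))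

theorem coeff_mix (s : (Fin 4 →₀ ℕ) → Fin 4) (f : Fin 4 → Coord k) (e : Fin 4 →₀ ℕ) :
    coeff e (mix s f) = coeff e (f (s e)) := by
  classical
  rw [mix, coeff_sum, Finset.sum_eq_single (s e)]
  · rw [coeff_sum]
    simp only [coeff_monomial]
    rw [Finset.sum_ite_eq']
    split_ifs with h
    · rfl
    · simpa [eq_comm] using h
  · intro v _ hv
    rw [coeff_sum]
    refine Finset.sum_eq_zero fun d hd => ?_
    rw [coeff_monomial, if_neg]
    rintro rfl
    exact hv (Finset.mem_filter.mp hd).2.symm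
  · simp

theorem isHomogeneous_mix {s : (Fin 4 →₀ ℕ) → Fin 4} {f : Fin 4 → Coord k} {d : ℕ}
    (hf : ∀ v, (f v).IsHomogeneous d) : (mix s f).IsHomogeneous d := by
  intro e he
  rw [coeff_mix] at he
  exact hf _ he

theorem X_pow_dvd_iff_le {p : Coord k} {q : Fin 4} {n : ℕ} :
    X q ^ n ∣ p ↔ ∀ e, coeff e p ≠ 0 → n ≤ e q := by
  rw [X_pow_eq_monomial, monomial_one_dvd_iff_modMonomial_eq_zero]
  constructor
  · intro h e he
    by_contra hlt
    have hn : ¬ Finsupp.single q n ≤ e := by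
      rwa [Finsupp.single_le_iff]
    have := coeff_modMonomial_of_not_le p hn
    rw [h, coeff_zero] at this
    exact he this.symm
  · intro h
    ext e
    rw [coeff_zero]
    by_cases hle : Finsupp.single q n ≤ e
    · exact coeff_modMonomial_of_le p hle
    · rw [coeff_modMonomial_of_not_le p hle]
      by_contra hne
      exact hle (Finsupp.single_le_iff.mpr (h e hne))

/-- An index at which `e` is at least `n`, if there is one. -/
def bigIndex (n : ℕ) (e : Fin 4 →₀ ℕ) : Fin 4 :=
  open Classical in if h : ∃ q, n ≤ e q then h.choose else 0

theorem le_apply_bigIndex {n : ℕ} {e : Fin 4 →₀ ℕ} {q : Fin 4} (h : n ≤ e q) :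
    n ≤ e (bigIndex n e) := by
  have h' : ∃ q, n ≤ e q := ⟨q, h⟩
  rw [bigIndex, dif_pos h']
  exact h'.choose_spec

/-- At a monomial `e` the selected polynomial is `f v` with `v = bigIndex n e`, and divisibility is
in doubt only for `X v`. As `T` and `v` leave one of the four indices free, `e` has an exponent at
least `n` there; `bigIndex` then guarantees one at `v` too. This bound on `T` is what limits the
vanishing to degrees one and two. -/
theorem X_pow_dvd_mix {n : ℕ} {f : Fin 4 → Coord k} {T : Finset (Fin 4)} (hT : T.card ≤ 2)
    (hf : ∀ v q, q ≠ v → q ∉ T → X q ^ n ∣ f v) {q : Fin 4} (hq : q ∉ T) :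
    X q ^ n ∣ mix (bigIndex n) f := by
  simp only [X_pow_dvd_iff_le] at hf ⊢
  intro e he
  rw [coeff_mix] at he
  by_cases hqv : q = bigIndex n e
  · have : ∃ q', q' ∉ insert (bigIndex n e) T := by
      by_contra! hall
      have h1 : (insert (bigIndex n e) T) = Finset.univ := Finset.eq_univ_iff_forall.mpr hall
      have h2 := Finset.card_insert_le (bigIndex n e) T
      rw [h1, Finset.card_univ, Fintype.card_fin] at h2
      omega
    obtain ⟨q', hq'⟩ := this
    rw [Finset.mem_insert, not_or] at hq'
    rw [hqv]
    exact le_apply_bigIndex (hf _ q' hq'.1 hq'.2 e he)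
  · exact hf _ q hqv hq e he

end Selection

/-! ### Vanishing of H¹ and H² for the structure sheaf -/

section Cech

variable {k : Type*} [Field k]

/-- The product of the four variables. -/
def allX (k : Type*) [Field k] : Coord k := ∏ i : Fin 4, X i

theorem allX_ne_zero : allX k ≠ 0 := Finset.prod_ne_zero_iff.mpr fun i _ => X_ne_zero i

theorem isHomogeneous_allX : (allX k).IsHomogeneous 4 := by
  have := IsHomogeneous.prod Finset.univ (fun i : Fin 4 => (X i : Coord k)) (fun _ => 1)
    fun i _ => isHomogeneous_X k i
  simpa [allX] using this

theorem X_dvd_allX (i : Fin 4) : X i ∣ allX k := Finset.dvd_prod_of_mem _ (Finset.mem_univ i)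

/-- Clearing denominators of a section of the structure sheaf. -/
theorem eventually_exists_numerator {h : Coord k} {g : Frac k} {m : ℕ}
    (hg : g ∈ sectionsOn ⊤ h) (hdvd : h ∣ allX k ^ m) :
    ∀ᶠ N : ℕ in Filter.atTop, ∃ p : Coord k,
      algebraMap (Coord k) (Frac k) (allX k ^ (m * N)) * g = algebraMap (Coord k) (Frac k) p ∧
      ∀ q, ¬ X q ∣ h → X q ^ (m * N) ∣ p := by
  obtain ⟨n, f, -, hf⟩ := hg
  obtain ⟨w, hw⟩ := hdvd
  filter_upwards [Filter.eventually_ge_atTop n] with N hN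
  obtain ⟨r, rfl⟩ := Nat.exists_eq_add_of_le hN
  refine ⟨w ^ (n + r) * h ^ r * f, ?_, fun q hq => ?_⟩
  · rw [pow_mul, hw, map_mul, ← hf, ← mul_assoc, ← map_mul]
    congr 2
    ring
  -- A prime variable not dividing `h` contributes nothing to the denominator, so its full power
  -- survives in the numerator.
  · have h1 : X q ^ (m * (n + r)) ∣ h ^ (n + r) * (w ^ (n + r) * h ^ r * f) := by
      have h2 : h ^ (n + r) * (w ^ (n + r) * h ^ r * f) = allX k ^ (m * (n + r)) * (h ^ r * f) := by
        rw [pow_mul, hw]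
        ring
      rw [h2]
      exact Dvd.dvd.mul_right (pow_dvd_pow_of_dvd (X_dvd_allX q) _) _
    have hp : Prime (X q : Coord k) := X_prime
    exact hp.pow_dvd_of_dvd_mul_left _ (fun hd => hq (hp.dvd_of_dvd_pow hd)) h1

/-- A fraction with denominator a power of `x₀x₁x₂x₃` whose numerator is divisible enough. -/
theorem div_mem_sectionsOn {T : Finset (Fin 4)} {h p : Coord k} {n : ℕ} {g : Frac k}
    (hT : ∏ i ∈ T, X i ∣ h) (hp : ∀ q ∉ T, X q ^ n ∣ p)
    (hg : algebraMap (Coord k) (Frac k) (allX k ^ n) * g = algebraMap (Coord k) (Frac k) p) :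
    g ∈ sectionsOn ⊤ h := by
  have h1 : ∏ q ∈ Tᶜ, (X q : Coord k) ^ n ∣ p := by
    refine Finset.prod_dvd_of_isRelPrime (fun i _ j _ hij => ?_) fun q hq =>
      hp q (Finset.mem_compl.mp hq)
    refine IsRelPrime.pow ?_
    refine ((X_prime (i := i)).irreducible.isRelPrime_iff_not_dvd).mpr fun hd => hij ?_
    rwa [X_dvd_X] at hd
  obtain ⟨c, rfl⟩ := h1
  obtain ⟨w, rfl⟩ := hT
  refine ⟨n, w ^ n * c, trivial, ?_⟩
  have h0 : algebraMap (Coord k) (Frac k) (allX k ^ n) ≠ 0 := by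
    rw [Ne, FaithfulSMul.algebraMap_eq_zero_iff]
    exact pow_ne_zero _ allX_ne_zero
  refine mul_left_cancel₀ h0 ?_
  rw [mul_left_comm, hg, ← map_mul, ← map_mul]
  congr 1
  rw [allX, ← Finset.prod_mul_prod_compl T, Finset.prod_pow]
  ring

/-- The Čech cohomology of the structure sheaf of projective three-space and its twists vanishes
in degree one. -/
theorem exists_cochain₀_of_cocycle {c : Fin 4 → Fin 4 → Frac k}
    (hc : ∀ i j, c i j ∈ sectionsOn ⊤ (X i * X j)) (hδ : ∀ i j l, c j l - c i l + c i j = 0) :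
    ∃ d : Fin 4 → Frac k, (∀ i, d i ∈ sectionsOn ⊤ (X i)) ∧ ∀ i j, d j - d i = c i j := by
  have h1 : ∀ i j, X i * X j ∣ allX k ^ 2 := fun i j => by
    rw [pow_two]
    exact mul_dvd_mul (X_dvd_allX i) (X_dvd_allX j)
  have h2 := Filter.eventually_all.mpr fun i => Filter.eventually_all.mpr fun j =>
    eventually_exists_numerator (hc i j) (h1 i j)
  obtain ⟨N, hN⟩ := h2.exists
  choose p hp hpX using hN
  set n := 2 * N with hn
  have h0 : algebraMap (Coord k) (Frac k) (allX k ^ n) ≠ 0 := by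
    rw [Ne, FaithfulSMul.algebraMap_eq_zero_iff]
    exact pow_ne_zero _ allX_ne_zero
  have hpδ : ∀ i j l, p j l - p i l + p i j = 0 := fun i j l => by
    apply IsFractionRing.injective (Coord k) (Frac k)
    rw [map_add, map_sub, ← hp, ← hp, ← hp, ← mul_sub, ← mul_add, hδ, mul_zero, map_zero]
  -- A cone contraction whose apex `v` varies with the monomial but not with `i`, so the cocycle
  -- relation with first index `v` can be used coefficient by coefficient.
  let q : Fin 4 → Coord k := fun i => mix (bigIndex n) fun v => p v i
  have hq : ∀ i j, q j - q i = p i j := fun i j => by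
    ext e
    rw [coeff_sub, coeff_mix, coeff_mix]
    have := congrArg (coeff e) (hpδ (bigIndex n e) i j)
    rw [coeff_add, coeff_sub, coeff_zero] at this
    linear_combination -this
  refine ⟨fun i => algebraMap _ _ (q i) / algebraMap _ _ (allX k ^ n), fun i => ?_, fun i j => ?_⟩
  · refine div_mem_sectionsOn (T := {i}) (p := q i) (n := n) (by simp) (fun r hr => ?_)
      (mul_div_cancel₀ _ h0)
    refine X_pow_dvd_mix (T := {i}) (by simp) (fun v r' hv hr' => hpX v i r' ?_) hr
    rw [X_prime.dvd_mul, X_dvd_X, X_dvd_X]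
    simp_all
  · rw [← sub_div, ← map_sub, hq, ← hp, mul_div_cancel_left₀ _ h0]

/-- The Čech cohomology of the structure sheaf of projective three-space and its twists vanishes
in degree two. -/
theorem exists_cochain₁_of_cocycle (t : ℤ) {c : Fin 4 → Fin 4 → Fin 4 → Frac k}
    (hc : ∀ i j l, c i j l ∈ sectionsOn ⊤ (X i * X j * X l))
    (hδ : ∀ i j l r, c j l r - c i l r + c i j r - c i j l = 0) :
    ∃ d : Fin 4 → Fin 4 → Frac k, (∀ i j, d i j ∈ sectionsOn ⊤ (X i * X j)) ∧
      (∀ i j l, d j l - d i l + d i j = c i j l) ∧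
      ((∀ i j l, c i j l ∈ fractionsOfDegree k t) → ∀ i j, d i j ∈ fractionsOfDegree k t) := by
  have h1 : ∀ i j l, X i * X j * X l ∣ allX k ^ 3 := fun i j l => by
    rw [pow_succ, pow_two]
    exact mul_dvd_mul (mul_dvd_mul (X_dvd_allX i) (X_dvd_allX j)) (X_dvd_allX l)
  have h2 := Filter.eventually_all.mpr fun i => Filter.eventually_all.mpr fun j =>
    Filter.eventually_all.mpr fun l => eventually_exists_numerator (hc i j l) (h1 i j l)
  -- The bound by |t| makes t + 4n nonnegative, so that it is the degree of the numerators.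
  obtain ⟨N, hN, hNt⟩ := (h2.and (Filter.eventually_ge_atTop t.natAbs)).exists
  choose p hp hpX using hN
  set n := 3 * N with hn
  have h0 : algebraMap (Coord k) (Frac k) (allX k ^ n) ≠ 0 := by
    rw [Ne, FaithfulSMul.algebraMap_eq_zero_iff]
    exact pow_ne_zero _ allX_ne_zero
  have hpδ : ∀ i j l r, p j l r - p i l r + p i j r - p i j l = 0 := fun i j l r => by
    apply IsFractionRing.injective (Coord k) (Frac k)
    rw [map_sub, map_add, map_sub, ← hp, ← hp, ← hp, ← hp, ← mul_sub, ← mul_add, ← mul_sub, hδ,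
      mul_zero, map_zero]
  let q : Fin 4 → Fin 4 → Coord k := fun i j => mix (bigIndex n) fun v => p v i j
  have hq : ∀ i j l, q j l - q i l + q i j = p i j l := fun i j l => by
    ext e
    rw [coeff_add, coeff_sub, coeff_mix, coeff_mix, coeff_mix]
    have := congrArg (coeff e) (hpδ (bigIndex n e) i j l)
    rw [coeff_sub, coeff_add, coeff_sub, coeff_zero] at this
    linear_combination -this
  refine ⟨fun i j => algebraMap _ _ (q i j) / algebraMap _ _ (allX k ^ n), fun i j => ?_,
    fun i j l => ?_, fun ht i j => ?_⟩
  · refine div_mem_sectionsOn (T := {i, j}) (p := q i j) (n := n) ?_ (fun r hr => ?_)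
      (mul_div_cancel₀ _ h0)
    · by_cases hij : i = j
      · subst hij
        simp
      · rw [Finset.prod_pair hij]
    · refine X_pow_dvd_mix (T := {i, j}) Finset.card_le_two
        (fun v r' hv hr' => hpX v i j r' ?_) hr
      rw [X_prime.dvd_mul, X_prime.dvd_mul, X_dvd_X, X_dvd_X, X_dvd_X]
      simp_all
  · rw [← sub_div, ← add_div, ← map_sub, ← map_add, hq, ← hp, mul_div_cancel_left₀ _ h0]
  · have hX : (allX k ^ n).IsHomogeneous (4 * n) := isHomogeneous_allX.pow n
    obtain ⟨d, hd⟩ : ∃ d : ℕ, (d : ℤ) = t + (4 * n : ℕ) := ⟨(t + (4 * n : ℕ)).toNat, by omega⟩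
    have hph : ∀ i j l, (p i j l).IsHomogeneous d := fun i j l => by
      apply isHomogeneous_of_algebraMap_mem
      rw [← hp]
      exact algebraMap_mul_mem_fractionsOfDegree hX (ht i j l) hd
    refine mem_fractionsOfDegree_of_algebraMap_mul hX (pow_ne_zero _ allX_ne_zero) hd ?_
    rw [mul_div_cancel₀ _ h0]
    exact algebraMap_mem_fractionsOfDegree (isHomogeneous_mix fun v => hph v i j)

end Cech

/-! ### Functoriality of sections; cocycles in terms of entries -/

section Sections

variable {k : Type*} [Field k]

theorem sectionsOn_le_top (I : Ideal (Coord k)) (h : Coord k) : sectionsOn I h ≤ sectionsOn ⊤ h := by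
  rintro g ⟨n, f, -, hf⟩
  exact ⟨n, f, trivial, hf⟩

theorem sectionsOn_le_of_dvd (I : Ideal (Coord k)) {h h' : Coord k} (hh : h ∣ h') :
    sectionsOn I h ≤ sectionsOn I h' := by
  rintro g ⟨n, f, hfI, hf⟩
  obtain ⟨w, rfl⟩ := hh
  refine ⟨n, w ^ n * f, I.mul_mem_left _ hfI, ?_⟩
  rw [mul_pow, map_mul, map_mul, ← hf]
  ring

theorem algebraMap_mul_mem_sectionsOn {I J : Ideal (Coord k)} {c : Coord k}
    (hc : ∀ x ∈ I, c * x ∈ J) {h : Coord k} {g : Frac k} (hg : g ∈ sectionsOn I h) :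
    algebraMap (Coord k) (Frac k) c * g ∈ sectionsOn J h := by
  obtain ⟨n, f, hfI, hf⟩ := hg
  refine ⟨n, c * f, hc f hfI, ?_⟩
  rw [map_mul, ← hf]
  ring

/-- The coboundary of a `1`-cochain has its entries in the sections over triple intersections. -/
theorem delta₁_mem_sectionsOn {I : Ideal (Coord k)} {c : Fin 4 → Fin 4 → Frac k}
    (hc : ∀ i j, c i j ∈ sectionsOn I (X i * X j)) (i j l : Fin 4) :
    c j l - c i l + c i j ∈ sectionsOn I (X i * X j * X l) := by
  refine Submodule.add_mem _ (Submodule.sub_mem _ ?_ ?_) ?_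
  · exact sectionsOn_le_of_dvd I ⟨X i, by ring⟩ (hc j l)
  · exact sectionsOn_le_of_dvd I ⟨X j, by ring⟩ (hc i l)
  · exact sectionsOn_le_of_dvd I ⟨X l, by ring⟩ (hc i j)

theorem delta₀_mem_sectionsOn {I : Ideal (Coord k)} {b : Fin 4 → Frac k}
    (hb : ∀ i, b i ∈ sectionsOn I (X i)) (i j : Fin 4) :
    b j - b i ∈ sectionsOn I (X i * X j) :=
  Submodule.sub_mem _ (sectionsOn_le_of_dvd I ⟨X i, by ring⟩ (hb j))
    (sectionsOn_le_of_dvd I ⟨X j, by ring⟩ (hb i))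

theorem mem_cocycle₁_iff {I : Ideal (Coord k)} {c : Fin 4 → Fin 4 → Frac k} :
    c ∈ cocycle₁ I ↔
      (∀ i j, c i j ∈ sectionsOn I (X i * X j)) ∧ ∀ i j l, c j l - c i l + c i j = 0 := by
  refine and_congr Iff.rfl ?_
  change delta₁ k c = 0 ↔ _
  simp only [funext_iff]
  rfl

theorem mem_coboundary₁_iff {I : Ideal (Coord k)} {c : Fin 4 → Fin 4 → Frac k} :
    c ∈ coboundary₁ I ↔
      ∃ b : Fin 4 → Frac k, (∀ i, b i ∈ sectionsOn I (X i)) ∧ ∀ i j, c i j = b j - b i := by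
  constructor
  · rintro ⟨b, hb, rfl⟩
    exact ⟨b, hb, fun i j => rfl⟩
  · rintro ⟨b, hb, h⟩
    refine ⟨b, hb, ?_⟩
    funext i j
    exact (h i j).symm

end Sections

/-! ### Liaison addition on cochains -/

section Liaison

variable {k : Type*} [Field k]

/-- The data of a liaison addition: `I = G A + F B` with forms `F ∈ A`, `G ∈ B` without common
factor, of degrees `m` and `p`, and homogeneous ideals `A`, `B`. -/
structure LiaisonSum (A B I : Ideal (Coord k)) (F G : Coord k) (m p : ℕ) : Prop where
  hF : F.IsHomogeneous m
  hG : G.IsHomogeneous p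
  hF0 : F ≠ 0
  isRelPrime : IsRelPrime F G
  hFA : F ∈ A
  hGB : G ∈ B
  hA : ∀ f ∈ A, ∀ d, homogeneousComponent d f ∈ A
  hB : ∀ f ∈ B, ∀ d, homogeneousComponent d f ∈ B
  mem_iff : ∀ f, f ∈ I ↔ ∃ a ∈ A, ∃ b ∈ B, f = G * a + F * b

namespace LiaisonSum

variable {A B I : Ideal (Coord k)} {F G : Coord k} {m p : ℕ}

local notation "ι" => algebraMap (Coord k) (Frac k)

theorem mul_left_mem (H : LiaisonSum A B I F G m p) : ∀ x ∈ A, G * x ∈ I := fun x hx =>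
  (H.mem_iff _).mpr ⟨x, hx, 0, B.zero_mem, by ring⟩

theorem mul_right_mem (H : LiaisonSum A B I F G m p) : ∀ x ∈ B, F * x ∈ I := fun x hx =>
  (H.mem_iff _).mpr ⟨0, A.zero_mem, x, hx, by ring⟩

theorem algebraMap_F_ne_zero (H : LiaisonSum A B I F G m p) : ι F ≠ 0 := by
  rw [Ne, FaithfulSMul.algebraMap_eq_zero_iff]
  exact H.hF0

/-- A form in `I` of degree `d` is `G a + F b` with forms `a ∈ A`, `b ∈ B`. -/
theorem exists_isHomogeneous (H : LiaisonSum A B I F G m p) {f : Coord k} (hf : f ∈ I) {d : ℕ}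
    (hd : f.IsHomogeneous d) : ∃ a ∈ A, ∃ b ∈ B, f = G * a + F * b ∧
      ι a ∈ fractionsOfDegree k (d - p) ∧ ι b ∈ fractionsOfDegree k (d - m) := by
  obtain ⟨a, ha, b, hb, rfl⟩ := (H.mem_iff f).mp hf
  have hsplit : ∀ (J : Ideal (Coord k)) (P c : Coord k) (n : ℕ), P.IsHomogeneous n →
      (∀ f ∈ J, ∀ d, homogeneousComponent d f ∈ J) → c ∈ J →
      ∃ c' ∈ J, homogeneousComponent d (P * c) = P * c' ∧
        ι c' ∈ fractionsOfDegree k ((d : ℤ) - n) := by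
    intro J P c n hP hJ hc
    by_cases hdn : d < n
    · refine ⟨0, J.zero_mem, ?_, ?_⟩
      · rw [homogeneousComponent_mul_of_lt hP c hdn, mul_zero]
      · rw [map_zero]
        exact Submodule.zero_mem _
    · obtain ⟨r, rfl⟩ := Nat.exists_eq_add_of_le (not_lt.mp hdn)
      refine ⟨homogeneousComponent r c, hJ c hc r, homogeneousComponent_add_mul hP c r, ?_⟩
      have := algebraMap_mem_fractionsOfDegree (homogeneousComponent_isHomogeneous r c)
      rwa [Nat.cast_add, add_sub_cancel_left]
  obtain ⟨a', ha', ea, da⟩ := hsplit A G a p H.hG H.hA ha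
  obtain ⟨b', hb', eb, db⟩ := hsplit B F b m H.hF H.hB hb
  refine ⟨a', ha', b', hb', ?_, da, db⟩
  rw [← homogeneousComponent_eq_self hd, map_add, ea, eb]

/-- Clear the denominator, decompose the numerator in `I`, divide again. The degree claim is an
implication, so one choice serves graded and ungraded uses. -/
theorem exists_split (H : LiaisonSum A B I F G m p) {h : Coord k} (h0 : h ≠ 0) {e : ℕ}
    (he : h.IsHomogeneous e) (t : ℤ) {g : Frac k} (hg : g ∈ sectionsOn I h) :
    ∃ a ∈ sectionsOn A h, ∃ b ∈ sectionsOn B h, g = ι G * a + ι F * b ∧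
      (g ∈ fractionsOfDegree k t →
        a ∈ fractionsOfDegree k (t - p) ∧ b ∈ fractionsOfDegree k (t - m)) := by
  obtain ⟨n, f, hfI, hf⟩ := hg
  have hn0 : h ^ n ≠ 0 := pow_ne_zero _ h0
  have hι : ι (h ^ n) ≠ 0 := by
    rwa [Ne, FaithfulSMul.algebraMap_eq_zero_iff]
  have hen : (h ^ n).IsHomogeneous (e * n) := he.pow n
  have key : ∃ a ∈ A, ∃ b ∈ B, f = G * a + F * b ∧
      (g ∈ fractionsOfDegree k t → ι a ∈ fractionsOfDegree k (t - p + (e * n : ℕ)) ∧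
        ι b ∈ fractionsOfDegree k (t - m + (e * n : ℕ))) := by
    by_cases ht : g ∈ fractionsOfDegree k t
    · have hft : ι f ∈ fractionsOfDegree k (t + (e * n : ℕ)) := by
        rw [← hf]
        exact algebraMap_mul_mem_fractionsOfDegree hen ht rfl
      -- A polynomial of negative degree is zero; otherwise the numerator is a form and splits into
      -- forms.
      by_cases hneg : t + (e * n : ℕ) < 0
      · have hf0 : f = 0 := eq_zero_of_algebraMap_mem_of_neg hneg hft
        refine ⟨0, A.zero_mem, 0, B.zero_mem, by rw [hf0]; ring, fun _ => ?_⟩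
        rw [map_zero]
        exact ⟨Submodule.zero_mem _, Submodule.zero_mem _⟩
      · obtain ⟨d, hd⟩ : ∃ d : ℕ, (d : ℤ) = t + (e * n : ℕ) := ⟨_, Int.toNat_of_nonneg (by omega)⟩
        rw [← hd] at hft
        obtain ⟨a, ha, b, hb, hab, da, db⟩ :=
          H.exists_isHomogeneous hfI (isHomogeneous_of_algebraMap_mem hft)
        refine ⟨a, ha, b, hb, hab, fun _ => ⟨?_, ?_⟩⟩
        · rwa [hd, add_sub_right_comm] at da
        · rwa [hd, add_sub_right_comm] at db
    · obtain ⟨a, ha, b, hb, hab⟩ := (H.mem_iff f).mp hfI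
      exact ⟨a, ha, b, hb, hab, fun h => absurd h ht⟩
  obtain ⟨a, ha, b, hb, hab, hdeg⟩ := key
  refine ⟨ι a / ι (h ^ n), ⟨n, a, ha, mul_div_cancel₀ _ hι⟩, ι b / ι (h ^ n),
    ⟨n, b, hb, mul_div_cancel₀ _ hι⟩, ?_, fun ht => ?_⟩
  · refine mul_left_cancel₀ hι ?_
    rw [hf, hab, map_add, map_mul, map_mul]
    field_simp
  · obtain ⟨da, db⟩ := hdeg ht
    constructor
    · refine mem_fractionsOfDegree_of_algebraMap_mul hen hn0 rfl ?_
      rwa [mul_div_cancel₀ _ hι]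
    · refine mem_fractionsOfDegree_of_algebraMap_mul hen hn0 rfl ?_
      rwa [mul_div_cancel₀ _ hι]

/-- The Koszul relation: `F` divides `G` times the numerator of `a`, and is coprime to `G`. The
quotient `c` is an arbitrary section of the structure sheaf, where cohomology vanishes. -/
theorem exists_syzygy (H : LiaisonSum A B I F G m p) {h : Coord k} (h0 : h ≠ 0)
    {a b : Frac k} (ha : a ∈ sectionsOn ⊤ h) (hb : b ∈ sectionsOn ⊤ h)
    (hab : ι G * a + ι F * b = 0) :
    ∃ c ∈ sectionsOn ⊤ h, a = ι F * c ∧ b = -(ι G * c) := by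
  obtain ⟨n, f, -, hf⟩ := ha
  obtain ⟨n', f', -, hf'⟩ := hb
  have hι : ι (h ^ (n + n')) ≠ 0 := by
    rw [Ne, FaithfulSMul.algebraMap_eq_zero_iff]
    exact pow_ne_zero _ h0
  have h1 : G * (h ^ n' * f) = F * -(h ^ n * f') := by
    apply IsFractionRing.injective (Coord k) (Frac k)
    rw [map_mul, map_mul, map_mul, map_neg, map_mul, ← hf, ← hf']
    simp only [map_pow]
    linear_combination ι h ^ n * ι h ^ n' * hab
  obtain ⟨c, hc⟩ : F ∣ h ^ n' * f :=
    H.isRelPrime.dvd_of_dvd_mul_left ⟨_, h1⟩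
  have hac : a = ι F * (ι c / ι (h ^ (n + n'))) := by
    refine mul_left_cancel₀ hι ?_
    rw [mul_left_comm, mul_div_cancel₀ _ hι, ← map_mul, ← hc, pow_add, map_mul, map_mul, ← hf]
    ring
  refine ⟨ι c / ι (h ^ (n + n')), ⟨n + n', c, trivial, mul_div_cancel₀ _ hι⟩, hac, ?_⟩
  refine mul_left_cancel₀ H.algebraMap_F_ne_zero ?_
  rw [hac] at hab
  linear_combination hab

/-- Lifting of cocycles along `A ⊕ B → I`, compatible with degrees. -/
theorem exists_lift_cocycle (H : LiaisonSum A B I F G m p) (t : ℤ)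
    {z : Fin 4 → Fin 4 → Frac k} (hz : z ∈ cocycle₁ I) :
    ∃ a ∈ cocycle₁ A, ∃ b ∈ cocycle₁ B, (∀ i j, z i j = ι G * a i j + ι F * b i j) ∧
      ((∀ i j, z i j ∈ fractionsOfDegree k t) →
        (∀ i j, a i j ∈ fractionsOfDegree k (t - p)) ∧
        ∀ i j, b i j ∈ fractionsOfDegree k (t - m)) := by
  simp only [mem_cocycle₁_iff] at hz ⊢
  obtain ⟨hzI, hzδ⟩ := hz
  choose a ha b hb hab hdeg using fun i j =>
    H.exists_split (mul_ne_zero (X_ne_zero i) (X_ne_zero j))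
      ((isHomogeneous_X k i).mul (isHomogeneous_X k j)) t (hzI i j)
  -- Local splittings need not form cocycles. Since `z` is one, their coboundaries form a syzygy;
  -- the resulting `c` is the connecting 2-cocycle.
  choose c hc hca hcb using fun i j l =>
    H.exists_syzygy (mul_ne_zero (mul_ne_zero (X_ne_zero i) (X_ne_zero j)) (X_ne_zero l))
      (sectionsOn_le_top _ _ (delta₁_mem_sectionsOn ha i j l))
      (sectionsOn_le_top _ _ (delta₁_mem_sectionsOn hb i j l))
      (by linear_combination hzδ i j l - hab j l + hab i l - hab i j)
  have hcδ : ∀ i j l r, c j l r - c i l r + c i j r - c i j l = 0 := fun i j l r => by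
    refine mul_left_cancel₀ H.algebraMap_F_ne_zero ?_
    linear_combination -hca j l r + hca i l r - hca i j r + hca i j l
  -- With δd = c, replacing (a, b) by (a - Fd, b + Gd) leaves Ga + Fb unchanged and makes both
  -- entries cocycles.
  obtain ⟨d, hd, hdδ, hddeg⟩ := exists_cochain₁_of_cocycle (t - p - m) hc hcδ
  refine ⟨fun i j => a i j - ι F * d i j, ⟨fun i j => ?_, fun i j l => ?_⟩,
    fun i j => b i j + ι G * d i j, ⟨fun i j => ?_, fun i j l => ?_⟩, fun i j => ?_, fun ht => ?_⟩
  · exact Submodule.sub_mem _ (ha i j)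
      (algebraMap_mul_mem_sectionsOn (fun x _ => A.mul_mem_right _ H.hFA) (hd i j))
  · linear_combination hca i j l - ι F * hdδ i j l
  · exact Submodule.add_mem _ (hb i j)
      (algebraMap_mul_mem_sectionsOn (fun x _ => B.mul_mem_right _ H.hGB) (hd i j))
  · linear_combination hcb i j l + ι G * hdδ i j l
  · linear_combination hab i j
  · have hda : ∀ i j, a i j ∈ fractionsOfDegree k (t - p) := fun i j => (hdeg i j (ht i j)).1
    have hdb : ∀ i j, b i j ∈ fractionsOfDegree k (t - m) := fun i j => (hdeg i j (ht i j)).2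
    have hdd := hddeg fun i j l => by
      refine mem_fractionsOfDegree_of_algebraMap_mul (s := t - p) H.hF H.hF0 (by ring) ?_
      rw [← hca]
      exact Submodule.add_mem _ (Submodule.sub_mem _ (hda j l) (hda i l)) (hda i j)
    exact ⟨fun i j => Submodule.sub_mem _ (hda i j)
        (algebraMap_mul_mem_fractionsOfDegree H.hF (hdd i j) (by ring)),
      fun i j => Submodule.add_mem _ (hdb i j)
        (algebraMap_mul_mem_fractionsOfDegree H.hG (hdd i j) (by ring))⟩

/-- A pair of cocycles that becomes a coboundary of `I` consists of coboundaries. -/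
theorem mem_coboundary₁_of_mem_coboundary₁ (H : LiaisonSum A B I F G m p)
    {a b z : Fin 4 → Fin 4 → Frac k} (ha : a ∈ cocycle₁ A) (hb : b ∈ cocycle₁ B)
    (hz : z ∈ coboundary₁ I) (hab : ∀ i j, z i j = ι G * a i j + ι F * b i j) :
    a ∈ coboundary₁ A ∧ b ∈ coboundary₁ B := by
  rw [mem_cocycle₁_iff] at ha hb
  rw [mem_coboundary₁_iff] at hz
  simp only [mem_coboundary₁_iff]
  obtain ⟨ha, haδ⟩ := ha
  obtain ⟨hb, hbδ⟩ := hb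
  obtain ⟨y, hy, hyz⟩ := hz
  choose a' ha' b' hb' hab' _ using fun i =>
    H.exists_split (X_ne_zero i) (isHomogeneous_X k i) 0 (hy i)
  choose c hc hca hcb using fun i j =>
    H.exists_syzygy (mul_ne_zero (X_ne_zero i) (X_ne_zero j))
      (sectionsOn_le_top _ _ (Submodule.sub_mem _ (ha i j) (delta₀_mem_sectionsOn ha' i j)))
      (sectionsOn_le_top _ _ (Submodule.sub_mem _ (hb i j) (delta₀_mem_sectionsOn hb' i j)))
      (by linear_combination -hab i j + hyz i j + hab' j - hab' i)
  have hcδ : ∀ i j l, c j l - c i l + c i j = 0 := fun i j l => by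
    refine mul_left_cancel₀ H.algebraMap_F_ne_zero ?_
    linear_combination -hca j l + hca i l - hca i j + haδ i j l
  obtain ⟨d, hd, hdδ⟩ := exists_cochain₀_of_cocycle hc hcδ
  refine ⟨⟨fun i => a' i + ι F * d i, fun i => ?_, fun i j => ?_⟩,
    ⟨fun i => b' i - ι G * d i, fun i => ?_, fun i j => ?_⟩⟩
  · exact Submodule.add_mem _ (ha' i)
      (algebraMap_mul_mem_sectionsOn (fun x _ => A.mul_mem_right _ H.hFA) (hd i))
  · linear_combination hca i j - ι F * hdδ i j
  · exact Submodule.sub_mem _ (hb' i)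
      (algebraMap_mul_mem_sectionsOn (fun x _ => B.mul_mem_right _ H.hGB) (hd i))
  · linear_combination hcb i j + ι G * hdδ i j

end LiaisonSum

end Liaison

/-! ### Multiplication maps on Hartshorne–Rao modules -/

section Map

variable {k : Type*} [Field k] {I J : Ideal (Coord k)} {c : Coord k}

/-- Multiplication by `c`, from cocycles of `I` to cocycles of `J ⊇ c I`. -/
def cocycleMul (hc : ∀ x ∈ I, c * x ∈ J) : cocycle₁ I →ₗ[Coord k] cocycle₁ J :=
  (LinearMap.lsmul (Coord k) (Fin 4 → Fin 4 → Frac k) c).restrict fun z hz => by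
    rw [mem_cocycle₁_iff] at hz ⊢
    refine ⟨fun i j => ?_, fun i j l => ?_⟩
    · have := algebraMap_mul_mem_sectionsOn hc (hz.1 i j)
      rwa [← Algebra.smul_def] at this
    · have := congrArg (c • ·) (hz.2 i j l)
      simpa [smul_add, smul_sub] using this

theorem cocycleMul_apply (hc : ∀ x ∈ I, c * x ∈ J) (z : cocycle₁ I) (i j : Fin 4) :
    (cocycleMul hc z).1 i j = algebraMap (Coord k) (Frac k) c * z.1 i j := by
  rw [← Algebra.smul_def]
  rfl

/-- Multiplication by `c` on Hartshorne-Rao modules. -/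
def hartshorneRaoMul (hc : ∀ x ∈ I, c * x ∈ J) : HartshorneRao I →ₗ[Coord k] HartshorneRao J :=
  Submodule.mapQ _ _ (cocycleMul hc) fun z hz => by
    change (z : Fin 4 → Fin 4 → Frac k) ∈ coboundary₁ I at hz
    change (cocycleMul hc z).1 ∈ coboundary₁ J
    rw [mem_coboundary₁_iff] at hz ⊢
    obtain ⟨b, hb, hbz⟩ := hz
    refine ⟨fun i => algebraMap _ _ c * b i, fun i => algebraMap_mul_mem_sectionsOn hc (hb i),
      fun i j => ?_⟩
    rw [cocycleMul_apply, hbz]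
    ring

theorem hartshorneRaoMul_mk (hc : ∀ x ∈ I, c * x ∈ J) (z : cocycle₁ I) :
    hartshorneRaoMul hc (Submodule.Quotient.mk z) = Submodule.Quotient.mk (cocycleMul hc z) :=
  rfl

end Map

/-! ### The graded isomorphism of liaison addition -/

section Isomorphism

variable {k : Type*} [Field k] {A B I : Ideal (Coord k)} {F G : Coord k} {m p : ℕ}

namespace LiaisonSum

/-- The map `(a, b) ↦ G a + F b` on Hartshorne-Rao modules. -/
def toHartshorneRao (H : LiaisonSum A B I F G m p) :
    (HartshorneRao A × HartshorneRao B) →ₗ[Coord k] HartshorneRao I :=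
  (hartshorneRaoMul H.mul_left_mem).coprod (hartshorneRaoMul H.mul_right_mem)

theorem toHartshorneRao_mk (H : LiaisonSum A B I F G m p) (a : cocycle₁ A) (b : cocycle₁ B) :
    H.toHartshorneRao (Submodule.Quotient.mk a, Submodule.Quotient.mk b) =
      Submodule.Quotient.mk (cocycleMul H.mul_left_mem a + cocycleMul H.mul_right_mem b) := by
  rw [toHartshorneRao, LinearMap.coprod_apply, hartshorneRaoMul_mk, hartshorneRaoMul_mk]
  rfl

theorem cocycleMul_add_apply (H : LiaisonSum A B I F G m p) (a : cocycle₁ A) (b : cocycle₁ B)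
    (i j : Fin 4) :
    (cocycleMul H.mul_left_mem a + cocycleMul H.mul_right_mem b).1 i j =
      algebraMap (Coord k) (Frac k) G * a.1 i j + algebraMap (Coord k) (Frac k) F * b.1 i j := by
  rw [← cocycleMul_apply H.mul_left_mem, ← cocycleMul_apply H.mul_right_mem]
  rfl

theorem toHartshorneRao_injective (H : LiaisonSum A B I F G m p) :
    Function.Injective H.toHartshorneRao := by
  rw [← LinearMap.ker_eq_bot, LinearMap.ker_eq_bot']
  rintro ⟨x, y⟩ hxy
  obtain ⟨a, rfl⟩ := Submodule.Quotient.mk_surjective _ x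
  obtain ⟨b, rfl⟩ := Submodule.Quotient.mk_surjective _ y
  rw [toHartshorneRao_mk, Submodule.Quotient.mk_eq_zero] at hxy
  obtain ⟨h1, h2⟩ := H.mem_coboundary₁_of_mem_coboundary₁ a.2 b.2 hxy
    (H.cocycleMul_add_apply a b)
  exact Prod.ext ((Submodule.Quotient.mk_eq_zero _).mpr h1)
    ((Submodule.Quotient.mk_eq_zero _).mpr h2)

theorem exists_toHartshorneRao_eq (H : LiaisonSum A B I F G m p) (t : ℤ) (z : cocycle₁ I) :
    ∃ (a : cocycle₁ A) (b : cocycle₁ B),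
      H.toHartshorneRao (Submodule.Quotient.mk a, Submodule.Quotient.mk b) =
        Submodule.Quotient.mk z ∧
      ((∀ i j, z.1 i j ∈ fractionsOfDegree k t) →
        (∀ i j, a.1 i j ∈ fractionsOfDegree k (t - p)) ∧
        ∀ i j, b.1 i j ∈ fractionsOfDegree k (t - m)) := by
  obtain ⟨a, ha, b, hb, hab, hdeg⟩ := H.exists_lift_cocycle t z.2
  refine ⟨⟨a, ha⟩, ⟨b, hb⟩, ?_, hdeg⟩
  rw [toHartshorneRao_mk]
  congr 1
  refine Subtype.ext (funext fun i => funext fun j => ?_)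
  rw [H.cocycleMul_add_apply, hab]

theorem toHartshorneRao_bijective (H : LiaisonSum A B I F G m p) :
    Function.Bijective H.toHartshorneRao := by
  refine ⟨H.toHartshorneRao_injective, fun x => ?_⟩
  obtain ⟨z, rfl⟩ := Submodule.Quotient.mk_surjective _ x
  obtain ⟨a, b, hab, -⟩ := H.exists_toHartshorneRao_eq 0 z
  exact ⟨_, hab⟩

theorem toHartshorneRao_mem_iff (H : LiaisonSum A B I F G m p) (t : ℤ)
    (x : HartshorneRao A × HartshorneRao B) :
    H.toHartshorneRao x ∈ hartshorneRaoDegree I t ↔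
      x ∈ sumGrading (twist (hartshorneRaoDegree A) (-(p : ℤ)))
        (twist (hartshorneRaoDegree B) (-(m : ℤ))) t := by
  have e1 : -(p : ℤ) + t = t - p := by ring
  have e2 : -(m : ℤ) + t = t - m := by ring
  rw [sumGrading, Submodule.mem_prod, twist, twist, e1, e2]
  constructor
  · rintro ⟨z, hz, hzx⟩
    obtain ⟨a, b, hab, hdeg⟩ := H.exists_toHartshorneRao_eq t z
    -- Injectivity identifies the homogeneous lift of `z` with the given preimage.
    have hx : (Submodule.Quotient.mk a, Submodule.Quotient.mk b) = x :=
      H.toHartshorneRao_injective (hab.trans hzx)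
    rw [← hx]
    exact ⟨⟨a, (hdeg hz).1, rfl⟩, ⟨b, (hdeg hz).2, rfl⟩⟩
  · obtain ⟨x, y⟩ := x
    rintro ⟨⟨a, ha, hax⟩, ⟨b, hb, hby⟩⟩
    dsimp only at hax hby
    subst hax hby
    rw [toHartshorneRao_mk]
    refine ⟨_, fun i j => ?_, rfl⟩
    rw [H.cocycleMul_add_apply]
    exact Submodule.add_mem _ (algebraMap_mul_mem_fractionsOfDegree H.hG (ha i j) (by ring))
      (algebraMap_mul_mem_fractionsOfDegree H.hF (hb i j) (by ring))

/-- Liaison addition. -/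
theorem gradedIso (H : LiaisonSum A B I F G m p) :
    GradedIso (hartshorneRaoDegree I)
      (sumGrading (twist (hartshorneRaoDegree A) (-(p : ℤ)))
        (twist (hartshorneRaoDegree B) (-(m : ℤ)))) := by
  refine ⟨(LinearEquiv.ofBijective _ H.toHartshorneRao_bijective).symm, fun t x => ?_⟩
  obtain ⟨y, rfl⟩ := H.toHartshorneRao_bijective.2 x
  rw [toHartshorneRao_mem_iff]
  have : (LinearEquiv.ofBijective _ H.toHartshorneRao_bijective).symm (H.toHartshorneRao y) = y :=
    (LinearEquiv.ofBijective _ H.toHartshorneRao_bijective).symm_apply_apply y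
  rw [this]

end LiaisonSum

end Isomorphism

/-! ### Complete intersections as intersections of ideals -/

section CompleteIntersection

/-- If f = u a_i + v b also lies in every other (a_j, b), then so does u a_i, and a_i can be
cancelled modulo (a_j, b); induction applies to u. -/
theorem mem_span_prod_pair_iff {R ι : Type*} [CommRing R] {a : ι → R} {b : R}
    (h : ∀ i j, i ≠ j → ∀ u, u * a i ∈ Ideal.span {a j, b} → u ∈ Ideal.span {a j, b})
    (s : Finset ι) (f : R) :
    f ∈ Ideal.span {∏ i ∈ s, a i, b} ↔ ∀ i ∈ s, f ∈ Ideal.span {a i, b} := by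
  classical
  induction s using Finset.induction_on generalizing f with
  | empty =>
    simp only [Finset.prod_empty, Finset.notMem_empty, false_imp_iff, imp_true_iff, iff_true]
    rw [(Ideal.eq_top_iff_one _).mpr (Ideal.subset_span (by simp))]
    trivial
  | insert i s hi ih =>
    rw [Finset.forall_mem_insert, ← ih, Finset.prod_insert hi]
    simp only [Ideal.mem_span_pair] at ih ⊢
    constructor
    · rintro ⟨u, v, rfl⟩
      exact ⟨⟨u * ∏ j ∈ s, a j, v, by ring⟩, ⟨u * a i, v, by ring⟩⟩
    · rintro ⟨⟨u, v, rfl⟩, hf⟩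
      rw [ih] at hf
      have hu : ∀ j ∈ s, ∃ x y, x * a j + y * b = u := by
        intro j hj
        have hij : i ≠ j := fun h => hi (h ▸ hj)
        rw [← Ideal.mem_span_pair]
        refine h i j hij u ?_
        rw [Ideal.mem_span_pair]
        obtain ⟨x, y, hxy⟩ := hf j hj
        exact ⟨x, y - v, by linear_combination hxy⟩
      obtain ⟨x, y, rfl⟩ := (ih u).mpr hu
      exact ⟨x, y * a i + v, by ring⟩

end CompleteIntersection

/-! ### Arrangements in general position and their ideals -/

section GeneralPosition

variable {k : Type*} [Field k]

/-- Two plane arrangements in general position: pairwise independent linear forms `L` and `M` such that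
no `M j` vanishes on a line `L i = L i' = 0` and no `L i` on a line `M j = M j' = 0`. -/
structure GeneralPosition {ι κ : Type*} (L : ι → Coord k) (M : κ → Coord k) : Prop where
  hL : ∀ i, (L i).IsHomogeneous 1
  hM : ∀ j, (M j).IsHomogeneous 1
  hL0 : ∀ i, L i ≠ 0
  hM0 : ∀ j, M j ≠ 0
  hLind : Pairwise fun i i' => LinearIndependent k ![L i, L i']
  hMind : Pairwise fun j j' => LinearIndependent k ![M j, M j']
  cross : ∀ i j, LinearIndependent k ![L i, M j]
  notMem_left : ∀ i i' j, i ≠ i' → M j ∉ Ideal.span {L i, L i'}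
  notMem_right : ∀ j j' i, j ≠ j' → L i ∉ Ideal.span {M j, M j'}

namespace GeneralPosition

variable {ι κ : Type*} {L : ι → Coord k} {M : κ → Coord k}

theorem symm (h : GeneralPosition L M) : GeneralPosition M L where
  hL := h.hM
  hM := h.hL
  hL0 := h.hM0
  hM0 := h.hL0
  hLind := h.hMind
  hMind := h.hLind
  cross := fun j i => linearIndependent_pair_swap (h.cross i j)
  notMem_left := h.notMem_right
  notMem_right := h.notMem_left

theorem isPrime_cross (h : GeneralPosition L M) (i : ι) (j : κ) :
    (Ideal.span {L i, M j}).IsPrime :=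
  isPrime_span_pair (h.cross i j) (h.hL i) (h.hM j)

theorem isPrime_left (h : GeneralPosition L M) {i i' : ι} (hi : i ≠ i') :
    (Ideal.span {L i, L i'}).IsPrime :=
  isPrime_span_pair (h.hLind hi) (h.hL i) (h.hL i')

/-- If a cross line lay on a further plane of `L`, it would be a line of F on which `M j` vanishes.
-/
theorem left_notMem_cross (h : GeneralPosition L M) {i l : ι} (hil : i ≠ l) (j : κ) :
    L l ∉ Ideal.span {L i, M j} := fun hm =>
  h.notMem_left i l j hil
    (mem_span_pair_exchange (h.cross i j) (h.hLind hil) (h.hL i) (h.hM j) (h.hL l) hm)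

theorem right_notMem_cross (h : GeneralPosition L M) {j l : κ} (hjl : j ≠ l) (i : ι) :
    M l ∉ Ideal.span {L i, M j} := by
  rw [Set.pair_comm]
  exact h.symm.left_notMem_cross hjl i

theorem mul_mem_cross_iff (h : GeneralPosition L M) (i : ι) (j : κ) {c u : Coord k}
    (hc : c ∉ Ideal.span {L i, M j}) (hu : u * c ∈ Ideal.span {L i, M j}) :
    u ∈ Ideal.span {L i, M j} :=
  ((h.isPrime_cross i j).mem_or_mem hu).resolve_right hc

theorem prod_right_notMem [Fintype κ] (h : GeneralPosition L M) {i i' : ι} (hi : i ≠ i') :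
    ∏ j, M j ∉ Ideal.span {L i, L i'} := fun hm => by
  obtain ⟨j, -, hj⟩ := ((h.isPrime_left hi).prod_mem_iff).mp hm
  exact h.notMem_left i i' j hi hj

/-- The complete intersection `F = G = 0` is the union of the lines `L i = M j = 0`. -/
theorem mem_span_prod_iff [Fintype ι] [Fintype κ] (h : GeneralPosition L M) (f : Coord k) :
    f ∈ Ideal.span {∏ i, L i, ∏ j, M j} ↔ ∀ i j, f ∈ Ideal.span {L i, M j} := by
  have h1 : ∀ (j : κ) (f : Coord k), f ∈ Ideal.span {M j, ∏ i, L i} ↔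
      ∀ i, f ∈ Ideal.span {L i, M j} := fun j f => by
    rw [Set.pair_comm, mem_span_prod_pair_iff]
    · simp
    · intro i i' hi u hu
      exact h.mul_mem_cross_iff i' j (h.left_notMem_cross hi.symm j) hu
  rw [Set.pair_comm, mem_span_prod_pair_iff]
  · simp only [Finset.mem_univ, true_imp_iff, h1]
    exact forall_comm
  · intro j j' hj u hu
    rw [h1] at hu ⊢
    exact fun i => h.mul_mem_cross_iff i j' (h.right_notMem_cross hj.symm i) (hu i)

theorem isRelPrime_prod [Fintype ι] [Fintype κ] (h : GeneralPosition L M) : IsRelPrime (∏ i, L i)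
    (∏ j, M j) := by
  refine IsRelPrime.prod_left fun i _ => IsRelPrime.prod_right fun j _ => ?_
  have hp : Prime (L i) := (Ideal.span_singleton_prime (h.hL0 i)).mp
    (isPrime_span_singleton (h.hL0 i) (h.hL i))
  rw [hp.irreducible.isRelPrime_iff_not_dvd, ← Ideal.mem_span_singleton]
  exact not_mem_span_singleton_of_linearIndependent (h.cross i j) (h.hL i) (h.hM j)

theorem pairwise_sumElim (h : GeneralPosition L M) :
    Pairwise fun a b : ι ⊕ κ => LinearIndependent k ![Sum.elim L M a, Sum.elim L M b] := by
  rintro (i | j) (i' | j') hne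
  · exact h.hLind fun e => hne (by rw [e])
  · exact h.cross i j'
  · exact h.symm.cross j i'
  · exact h.hMind fun e => hne (by rw [e])

theorem prod_sumElim [Fintype ι] [Fintype κ] : ∏ a, Sum.elim L M a = (∏ i, L i) * ∏ j, M j := by
  simp

theorem sumElim_isHomogeneous (h : GeneralPosition L M) (a : ι ⊕ κ) :
    (Sum.elim L M a).IsHomogeneous 1 := by
  rcases a with i | j
  exacts [h.hL i, h.hM j]

theorem sumElim_ne_zero (h : GeneralPosition L M) (a : ι ⊕ κ) : Sum.elim L M a ≠ 0 := by
  rcases a with i | j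
  exacts [h.hL0 i, h.hM0 j]

theorem mem_radical_iff [Fintype ι] [Fintype κ] [CharZero k] [Nonempty ι] [Nonempty κ]
    (h : GeneralPosition L M) (f : Coord k) :
    f ∈ (jacobianIdeal ((∏ i, L i) * ∏ j, M j)).radical ↔
      f ∈ (jacobianIdeal (∏ i, L i)).radical ∧ f ∈ (jacobianIdeal (∏ j, M j)).radical ∧
        f ∈ Ideal.span {∏ i, L i, ∏ j, M j} := by
  rw [← prod_sumElim, mem_radical_jacobianIdeal_prod h.sumElim_isHomogeneous h.sumElim_ne_zero
    h.pairwise_sumElim, mem_radical_jacobianIdeal_prod h.hL h.hL0 h.hLind,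
    mem_radical_jacobianIdeal_prod h.hM h.hM0 h.hMind, h.mem_span_prod_iff]
  constructor
  · intro hf
    exact ⟨fun i i' hi => hf (.inl i) (.inl i') (by simpa using hi),
      fun j j' hj => hf (.inr j) (.inr j') (by simpa using hj),
      fun i j => hf (.inl i) (.inr j) (by simp)⟩
  · rintro ⟨h1, h2, h3⟩ (i | j) (i' | j') hne
    · exact h1 i i' fun e => hne (by rw [e])
    · exact h3 i j'
    · have := h3 i' j
      rwa [Set.pair_comm] at this
    · exact h2 j j' fun e => hne (by rw [e])

theorem exists_mul_mem_jacobianIdeal_left [Fintype ι] [Fintype κ] [CharZero k] [Nonempty κ]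
    (h : GeneralPosition L M) {i i' : ι} (hi : i ≠ i')
    {f : Coord k} (hf : ∃ s ∉ Ideal.span {L i, L i'}, s * f ∈ jacobianIdeal (∏ i, L i)) :
    ∃ s ∉ Ideal.span {L i, L i'}, s * f ∈ jacobianIdeal ((∏ i, L i) * ∏ j, M j) := by
  have hself := prod_mem_jacobianIdeal h.sumElim_isHomogeneous
  rw [prod_sumElim] at hself
  obtain ⟨s, hs, hsf⟩ := hf
  refine ⟨(∏ j, M j) ^ 2 * s, fun hm => ?_, ?_⟩
  · rcases (h.isPrime_left hi).mem_or_mem hm with hm | hm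
    · exact h.prod_right_notMem hi ((h.isPrime_left hi).mem_of_pow_mem _ hm)
    · exact hs hm
  · rw [mul_assoc]
    exact sq_mul_mem_jacobianIdeal_mul hself hsf

/-- The multiplier is the square of the product of all other factors, none of which vanishes on the
cross line. -/
theorem exists_mul_mem_jacobianIdeal_cross [Fintype ι] [Fintype κ] [CharZero k] [Nonempty κ]
    (h : GeneralPosition L M) (i : ι) (j : κ)
    {f : Coord k} (hf : f ∈ Ideal.span {L i, M j}) :
    ∃ s ∉ Ideal.span {L i, M j}, s * f ∈ jacobianIdeal ((∏ i, L i) * ∏ j, M j) := by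
  classical
  have hself := prod_mem_jacobianIdeal h.sumElim_isHomogeneous
  rw [prod_sumElim] at hself
  have hprod : (∏ i, L i) * ∏ j, M j =
      L i * M j * ((∏ l ∈ Finset.univ.erase i, L l) * ∏ l ∈ Finset.univ.erase j, M l) := by
    rw [← Finset.mul_prod_erase _ L (Finset.mem_univ i),
      ← Finset.mul_prod_erase _ M (Finset.mem_univ j)]
    ring
  have hP := h.isPrime_cross i j
  rw [hprod] at hself ⊢
  refine ⟨_, fun hm => ?_,
    sq_mul_mem_jacobianIdeal_of_mem_span_pair (h.cross i j) (h.hL i) (h.hM j) hself hf⟩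
  rcases hP.mem_or_mem (hP.mem_of_pow_mem _ hm) with hm | hm
  · obtain ⟨l, hl, hm⟩ := (hP.prod_mem_iff).mp hm
    exact h.left_notMem_cross (Finset.ne_of_mem_erase hl).symm j hm
  · obtain ⟨l, hl, hm⟩ := (hP.prod_mem_iff).mp hm
    exact h.right_notMem_cross (Finset.ne_of_mem_erase hl).symm i hm

/-- The local conditions at the lines of FG split by type: lines of F give `QF`, lines of G give
`QG`, and cross lines, where the structure is reduced, give the complete intersection. -/
theorem mem_isTopDimensionalPart_iff [Fintype ι] [Fintype κ] [CharZero k] [Nonempty ι]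
    [Nonempty κ] (h : GeneralPosition L M) {QF QG QFG : Ideal (Coord k)}
    (hF : IsTopDimensionalPart (jacobianIdeal (∏ i, L i)) QF)
    (hG : IsTopDimensionalPart (jacobianIdeal (∏ j, M j)) QG)
    (hFG : IsTopDimensionalPart (jacobianIdeal ((∏ i, L i) * ∏ j, M j)) QFG) (f : Coord k) :
    f ∈ QFG ↔ f ∈ QF ∧ f ∈ QG ∧ f ∈ Ideal.span {∏ i, L i, ∏ j, M j} := by
  rw [← prod_sumElim] at hFG
  rw [hFG.mem_iff_of_prod h.sumElim_isHomogeneous h.sumElim_ne_zero h.pairwise_sumElim,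
    hF.mem_iff_of_prod h.hL h.hL0 h.hLind, hG.mem_iff_of_prod h.hM h.hM0 h.hMind,
    h.mem_span_prod_iff, prod_sumElim]
  constructor
  · intro hf
    refine ⟨fun i i' hi => ?_, fun j j' hj => ?_, fun i j => ?_⟩
    · obtain ⟨s, hs, hsf⟩ := hf (.inl i) (.inl i') (by simpa using hi)
      exact ⟨s, hs, jacobianIdeal_mul_le (prod_mem_jacobianIdeal h.hL) hsf⟩
    · obtain ⟨s, hs, hsf⟩ := hf (.inr j) (.inr j') (by simpa using hj)
      rw [mul_comm (∏ i, L i)] at hsf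
      exact ⟨s, hs, jacobianIdeal_mul_le (prod_mem_jacobianIdeal h.hM) hsf⟩
    · obtain ⟨s, hs, hsf⟩ := hf (.inl i) (.inr j) (by simp)
      have hle := (jacobianIdeal_prod_le_iff h.sumElim_isHomogeneous h.sumElim_ne_zero
        (h.isPrime_cross i j)).mpr ⟨.inl i, .inr j, by simp, Ideal.subset_span (by simp),
          Ideal.subset_span (by simp)⟩
      rw [prod_sumElim] at hle
      exact ((h.isPrime_cross i j).mem_or_mem (hle hsf)).resolve_left hs
  · rintro ⟨h1, h2, h3⟩ (i | j) (i' | j') hne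
    · have hi : i ≠ i' := fun e => hne (by rw [e])
      exact h.exists_mul_mem_jacobianIdeal_left hi (h1 i i' hi)
    · exact h.exists_mul_mem_jacobianIdeal_cross i j' (h3 i j')
    · have := h.exists_mul_mem_jacobianIdeal_cross i' j (h3 i' j)
      rwa [Set.pair_comm] at this
    · have hj : j ≠ j' := fun e => hne (by rw [e])
      rw [mul_comm (∏ i, L i)]
      exact h.symm.exists_mul_mem_jacobianIdeal_left hj (h2 j j' hj)

theorem mem_radical_of_prod_mul_mem [Fintype ι] [Fintype κ] [CharZero k] [Nonempty ι]
    (h : GeneralPosition L M) {x : Coord k}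
    (hx : (∏ j, M j) * x ∈ (jacobianIdeal (∏ i, L i)).radical) :
    x ∈ (jacobianIdeal (∏ i, L i)).radical := by
  rw [mem_radical_jacobianIdeal_prod h.hL h.hL0 h.hLind] at hx ⊢
  intro i i' hi
  exact ((h.isPrime_left hi).mem_or_mem (hx i i' hi)).resolve_left (h.prod_right_notMem hi)

theorem mem_isTopDimensionalPart_of_prod_mul_mem [Fintype ι] [Fintype κ] [CharZero k] [Nonempty ι]
    (h : GeneralPosition L M)
    {Q : Ideal (Coord k)} (hQ : IsTopDimensionalPart (jacobianIdeal (∏ i, L i)) Q) {x : Coord k}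
    (hx : (∏ j, M j) * x ∈ Q) : x ∈ Q := by
  rw [hQ.mem_iff_of_prod h.hL h.hL0 h.hLind] at hx ⊢
  intro i i' hi
  obtain ⟨s, hs, hsx⟩ := hx i i' hi
  refine ⟨s * ∏ j, M j, fun hm => ?_, by rwa [mul_assoc]⟩
  exact ((h.isPrime_left hi).mem_or_mem hm).elim hs (h.prod_right_notMem hi)

theorem homogeneousComponent_mem_radical [Fintype ι] [CharZero k] (h : GeneralPosition L M) :
    ∀ f ∈ (jacobianIdeal (∏ i, L i)).radical, ∀ d,
      homogeneousComponent d f ∈ (jacobianIdeal (∏ i, L i)).radical := fun _ hf d =>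
  homogeneousComponent_mem_of_scaling (fun _ hf => scaling_mem_radical
    (fun _ hg => scaling_mem_jacobianIdeal (isHomogeneous_prod h.hL) hg) hf) hf d

theorem homogeneousComponent_mem_isTopDimensionalPart [Fintype ι] [CharZero k] [Nonempty ι]
    (h : GeneralPosition L M)
    {Q : Ideal (Coord k)} (hQ : IsTopDimensionalPart (jacobianIdeal (∏ i, L i)) Q) :
    ∀ f ∈ Q, ∀ d, homogeneousComponent d f ∈ Q := fun f hf d => by
  refine homogeneousComponent_mem_of_scaling (fun g hg => ?_) hf d
  rw [hQ.mem_iff_of_prod h.hL h.hL0 h.hLind] at hg ⊢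
  intro i i' hi
  obtain ⟨s, hs, hsg⟩ := hg i i' hi
  -- The scaled multiplier stays outside the prime, because scaling by 1/2 preserves the prime and
  -- undoes scaling by 2.
  refine ⟨scaling 2 s, scaling_notMem_span_pair (inv_mul_cancel₀ two_ne_zero) (h.hL i) (h.hL i') hs,
    ?_⟩
  rw [← map_mul]
  exact scaling_mem_jacobianIdeal (isHomogeneous_prod h.hL) hsg

theorem jacobianIdeal_le_isTopDimensionalPart [Fintype ι] [CharZero k] [Nonempty ι]
    (h : GeneralPosition L M)
    {Q : Ideal (Coord k)} (hQ : IsTopDimensionalPart (jacobianIdeal (∏ i, L i)) Q) :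
    jacobianIdeal (∏ i, L i) ≤ Q := fun f hf => by
  rw [hQ.mem_iff_of_prod h.hL h.hL0 h.hLind]
  intro i i' hi
  exact ⟨1, (Ideal.ne_top_iff_one _).mp (h.isPrime_left hi).ne_top, by rwa [one_mul]⟩

/-- Ideals `A ∋ F` and `B ∋ G` and the intersection of `A`, `B` and `(F, G)` form a liaison
addition. -/
theorem liaisonSum [Fintype ι] [Fintype κ] (h : GeneralPosition L M) {A B I : Ideal (Coord k)}
    (hFA : ∏ i, L i ∈ A) (hGB : ∏ j, M j ∈ B)
    (hA : ∀ f ∈ A, ∀ d, homogeneousComponent d f ∈ A)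
    (hB : ∀ f ∈ B, ∀ d, homogeneousComponent d f ∈ B)
    (hGA : ∀ x, (∏ j, M j) * x ∈ A → x ∈ A) (hFB : ∀ x, (∏ i, L i) * x ∈ B → x ∈ B)
    (hI : ∀ f, f ∈ I ↔ f ∈ A ∧ f ∈ B ∧ f ∈ Ideal.span {∏ i, L i, ∏ j, M j}) :
    LiaisonSum A B I (∏ i, L i) (∏ j, M j) (Fintype.card ι) (Fintype.card κ) where
  hF := isHomogeneous_prod h.hL
  hG := isHomogeneous_prod h.hM
  hF0 := Finset.prod_ne_zero_iff.mpr fun i _ => h.hL0 i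
  isRelPrime := h.isRelPrime_prod
  hFA := hFA
  hGB := hGB
  hA := hA
  hB := hB
  mem_iff f := by
    rw [hI]
    constructor
    · rintro ⟨hfA, hfB, hf⟩
      -- From bF + aG ∈ A and F ∈ A follows aG ∈ A, and G cancels modulo A; symmetrically for b in
      -- B.
      obtain ⟨b, a, rfl⟩ := Ideal.mem_span_pair.mp hf
      refine ⟨a, hGA a ?_, b, hFB b ?_, by ring⟩
      · rw [mul_comm]
        exact (Ideal.add_mem_iff_right _ (A.mul_mem_left _ hFA)).mp hfA
      · rw [mul_comm]
        exact (Ideal.add_mem_iff_left _ (B.mul_mem_left _ hGB)).mp hfB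
    · rintro ⟨a, ha, b, hb, rfl⟩
      refine ⟨A.add_mem (A.mul_mem_left _ ha) (A.mul_mem_right _ hFA),
        B.add_mem (B.mul_mem_right _ hGB) (B.mul_mem_left _ hb), ?_⟩
      exact Ideal.mem_span_pair.mpr ⟨b, a, by ring⟩

theorem gradedIso_radical [Fintype ι] [Fintype κ] [CharZero k] [Nonempty ι] [Nonempty κ]
    (h : GeneralPosition L M) :
    GradedIso (hartshorneRaoDegree (jacobianIdeal ((∏ i, L i) * ∏ j, M j)).radical)
      (sumGrading
        (twist (hartshorneRaoDegree (jacobianIdeal (∏ i, L i)).radical) (-(Fintype.card κ : ℤ)))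
        (twist (hartshorneRaoDegree (jacobianIdeal (∏ j, M j)).radical)
          (-(Fintype.card ι : ℤ)))) :=
  (h.liaisonSum (Ideal.le_radical (prod_mem_jacobianIdeal h.hL))
    (Ideal.le_radical (prod_mem_jacobianIdeal h.hM)) h.homogeneousComponent_mem_radical
    h.symm.homogeneousComponent_mem_radical (fun _ => h.mem_radical_of_prod_mul_mem)
    (fun _ => h.symm.mem_radical_of_prod_mul_mem) h.mem_radical_iff).gradedIso

theorem gradedIso_isTopDimensionalPart [Fintype ι] [Fintype κ] [CharZero k] [Nonempty ι]
    [Nonempty κ] (h : GeneralPosition L M) {QF QG QFG : Ideal (Coord k)}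
    (hF : IsTopDimensionalPart (jacobianIdeal (∏ i, L i)) QF)
    (hG : IsTopDimensionalPart (jacobianIdeal (∏ j, M j)) QG)
    (hFG : IsTopDimensionalPart (jacobianIdeal ((∏ i, L i) * ∏ j, M j)) QFG) :
    GradedIso (hartshorneRaoDegree QFG)
      (sumGrading (twist (hartshorneRaoDegree QF) (-(Fintype.card κ : ℤ)))
        (twist (hartshorneRaoDegree QG) (-(Fintype.card ι : ℤ)))) :=
  (h.liaisonSum (h.jacobianIdeal_le_isTopDimensionalPart hF (prod_mem_jacobianIdeal h.hL))
    (h.symm.jacobianIdeal_le_isTopDimensionalPart hG (prod_mem_jacobianIdeal h.hM))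
    (h.homogeneousComponent_mem_isTopDimensionalPart hF)
    (h.symm.homogeneousComponent_mem_isTopDimensionalPart hG)
    (fun _ => h.mem_isTopDimensionalPart_of_prod_mul_mem hF)
    (fun _ => h.symm.mem_isTopDimensionalPart_of_prod_mul_mem hG)
    (h.mem_isTopDimensionalPart_iff hF hG hFG)).gradedIso

end GeneralPosition

theorem ne_zero_of_pairwise_linearIndependent {ι : Type*} [Nontrivial ι] {L : ι → Coord k}
    (h : Pairwise fun i i' => LinearIndependent k ![L i, L i']) (i : ι) : L i ≠ 0 := by
  obtain ⟨j, hj⟩ := exists_ne i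
  exact (h hj.symm).ne_zero 0

/-- If `G` vanishes on no component of the singular locus of `F`, no factor of `G` vanishes on
one of the lines `L i = L i' = 0`. -/
theorem notMem_span_pair_of_minimalPrimes [CharZero k] {ι κ : Type*} [Fintype ι] [Nontrivial ι]
    [Fintype κ] {L : ι → Coord k} {M : κ → Coord k} (hL : ∀ i, (L i).IsHomogeneous 1)
    (hLind : Pairwise fun i i' => LinearIndependent k ![L i, L i'])
    (h : ∀ P ∈ (jacobianIdeal (∏ i, L i)).radical.minimalPrimes, ∏ j, M j ∉ P)
    (i i' : ι) (j : κ) (hi : i ≠ i') : M j ∉ Ideal.span {L i, L i'} := by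
  intro hm
  refine h (Ideal.span {L i, L i'}) ?_ ?_
  · rw [Ideal.radical_minimalPrimes, mem_minimalPrimes_jacobianIdeal_prod hL
      (ne_zero_of_pairwise_linearIndependent hLind) hLind]
    exact ⟨i, i', hi, rfl⟩
  · exact Ideal.mem_of_dvd _ (Finset.dvd_prod_of_mem M (Finset.mem_univ j)) hm

theorem generalPosition_of_minimalPrimes [CharZero k] {ι κ : Type*} [Fintype ι] [Nontrivial ι]
    [Fintype κ] [Nontrivial κ] {L : ι → Coord k} {M : κ → Coord k}
    (hL : ∀ i, (L i).IsHomogeneous 1) (hM : ∀ j, (M j).IsHomogeneous 1)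
    (hLind : Pairwise fun i i' => LinearIndependent k ![L i, L i'])
    (hMind : Pairwise fun j j' => LinearIndependent k ![M j, M j'])
    (hGF : ∀ P ∈ (jacobianIdeal (∏ i, L i)).radical.minimalPrimes, ∏ j, M j ∉ P)
    (hFG : ∀ P ∈ (jacobianIdeal (∏ j, M j)).radical.minimalPrimes, ∏ i, L i ∉ P) :
    GeneralPosition L M where
  hL := hL
  hM := hM
  hL0 := ne_zero_of_pairwise_linearIndependent hLind
  hM0 := ne_zero_of_pairwise_linearIndependent hMind
  hLind := hLind
  hMind := hMind
  cross i j := by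
    rw [LinearIndependent.pair_iff' (ne_zero_of_pairwise_linearIndependent hLind i)]
    intro c hc
    -- A second factor is needed here: if `M j` were proportional to `L i`, it would vanish on the
    -- line `L i = L i' = 0`.
    obtain ⟨i', hi'⟩ := exists_ne i
    refine notMem_span_pair_of_minimalPrimes hL hLind hGF i i' j hi'.symm ?_
    rw [← hc, smul_eq_C_mul]
    exact Ideal.mul_mem_left _ _ (Ideal.subset_span (by simp))
  notMem_left := notMem_span_pair_of_minimalPrimes hL hLind hGF
  notMem_right := notMem_span_pair_of_minimalPrimes hM hMind hFG

end GeneralPosition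

end ProductArrangement
end

theorem proposition2p6 {k : Type*} [Field k] [CharZero k] (m p : ℕ) (hm : 2 ≤ m) (hp : 2 ≤ p)
    (L : Fin m → Coord k) (M : Fin p → Coord k)
    (hL : ∀ i, (L i).IsHomogeneous 1) (hM : ∀ j, (M j).IsHomogeneous 1)
    (hLind : Pairwise fun i i' => LinearIndependent k ![L i, L i'])
    (hMind : Pairwise fun j j' => LinearIndependent k ![M j, M j'])
    (F G : Coord k) (hF : F = ∏ i, L i) (hG : G = ∏ j, M j)
    (hGF : ∀ P ∈ (jacobianIdeal F).radical.minimalPrimes, G ∉ P)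
    (hFG : ∀ P ∈ (jacobianIdeal G).radical.minimalPrimes, F ∉ P) :
    (∀ QF QG QFG : Ideal (Coord k),
      IsTopDimensionalPart (jacobianIdeal F) QF →
      IsTopDimensionalPart (jacobianIdeal G) QG →
      IsTopDimensionalPart (jacobianIdeal (F * G)) QFG →
      GradedIso (hartshorneRaoDegree QFG)
        (sumGrading
          (twist (hartshorneRaoDegree QF) (-(p : ℤ)))
          (twist (hartshorneRaoDegree QG) (-(m : ℤ))))) ∧
    GradedIso
      (hartshorneRaoDegree
        (jacobianIdeal (F * G)).radical)
      (sumGrading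
        (twist (hartshorneRaoDegree
          (jacobianIdeal F).radical) (-(p : ℤ)))
        (twist (hartshorneRaoDegree
          (jacobianIdeal G).radical) (-(m : ℤ)))) := by
  have : Nontrivial (Fin m) := Fin.nontrivial_iff_two_le.mpr hm
  have : Nontrivial (Fin p) := Fin.nontrivial_iff_two_le.mpr hp
  subst hF hG
  have h := generalPosition_of_minimalPrimes hL hM hLind hMind hGF hFG
  refine ⟨fun QF QG QFG hQF hQG hQFG => ?_, ?_⟩
  · simpa only [Fintype.card_fin] using h.gradedIso_isTopDimensionalPart hQF hQG hQFG
  · simpa only [Fintype.card_fin] using h.gradedIso_radical
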